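/- Let $X_1,X_2,\dots$ be i.i.d. real random variables whose distribution function $F$ is continuous. Put $$\Delta=\int_{-\infty}^{\infty}\Big(P\Big(\tfrac{X_1X_2-1}{2X_2}\le t\Big)-P(X_3<t)\Big)\,dF(t),$$ $$h(x_1,x_2,x_3)=\tfrac13\Big(\mathrm I\big\{\tfrac{x_1x_2-1}{2x_2}\le x_3\big\}+\mathrm I\big\{\tfrac{x_1x_3-1}{2x_3}\le x_2\big\}+\mathrm I\big\{\tfrac{x_2x_3-1}{2x_3}\le x_1\big\}\Big)-\tfrac12,$$ $$\widehat\Delta^*_n=\binom n3^{-1}\sum_{1\le k<j<i\le n}\mathrm I\Big\{\tfrac{X_iX_j-1}{2X_j}\le X_k\Big\}-\tfrac12 .$$ For $1\le i\le n$ let $\widehat J_i=n\widehat\Delta^*_n-(n-1)\widehat\Delta^{*(-i)}_{n-1}$ be the jackknife pseudo-values, where $\widehat\Delta^{*(-i)}_{n-1}$ is the same statistic computed from the $n-1$ observations $X_1,\dots,X_{i-1},X_{i+1},\dots,X_n$ (in this order). The jackknife empirical likelihood ratio at $\theta\in\mathbb R$ is $$\mathcal R_n(\theta)=\max\Big\{\prod_{i=1}^n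 np_i:\ p_i\ge 0,\ \sum_{i=1}^n p_i=1,\ \sum_{i=1}^n p_i\widehat J_i=\theta\Big\},$$ with $\mathcal R_n(\theta)=0$ and $-2\log\mathcal R_n(\theta)=+\infty$ if no such $p$ exists. Assume that (1) $E[h^2(X_1,X_2,X_3)]<\infty$, and (2) $\sigma_1^2=\operatorname{Var}\big(E[h(X_1,X_2,X_3)\mid X_1]\big)>0$. Then, as $n\to\infty$, $-2\log\mathcal R_n(\Delta)$ converges in distribution (as extended real random variables) to the chi-squared distribution with one degree of freedom. In particular, under the null hypothesis that the $X_i$ have the standard Cauchy distribution $\mathcal C(0,1)$, one has $\Delta=0$ and $-2\log\mathcal R_n(0)$, the likelihood ratio statistic with the constraint $\sum_i p_i\widehat J_i=0$, converges in distribution to the chi-squared distribution with one degree of freedom. -/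

import Mathlib

open MeasureTheory ProbabilityTheory Filter

noncomputable section

namespace CauchyJEL

/-- The indicator of `(a b - 1) / (2 b) ≤ c`. -/
def kern (a b c : ℝ) : ℝ := if (a * b - 1) / (2 * b) ≤ c then 1 else 0

/-- The kernel `h` of the test statistic. -/
def h (x₁ x₂ x₃ : ℝ) : ℝ :=
  (1 / 3) * (kern x₁ x₂ x₃ + kern x₁ x₃ x₂ + kern x₂ x₃ x₁) - 1 / 2

/-- The measure of departure
`Δ = ∫ (P((X₁ X₂ - 1) / (2 X₂) ≤ t) - P(X₃ < t)) dF(t)` of a law `F` on the line. -/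
def departure (F : Measure ℝ) : ℝ :=
  ∫ t, ((F.prod F).real {q : ℝ × ℝ | (q.1 * q.2 - 1) / (2 * q.2) ≤ t} - F.real (Set.Iio t)) ∂F

/-- The estimator of `Δ` computed from the observations `x i`, `i ∈ S`, taken in the order of
their indices; it is the full-sample statistic for `S = {0, …, n - 1}`. -/
def deltaHat (x : ℕ → ℝ) (S : Finset ℕ) : ℝ :=
  ((S.card.choose 3 : ℕ) : ℝ)⁻¹ *
    (∑ i ∈ S, ∑ j ∈ S with j < i, ∑ k ∈ S with k < j, kern (x i) (x j) (x k)) - 1 / 2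

/-- The `i`-th jackknife pseudo-value of the sample `x 0, …, x (n - 1)`. -/
def pseudoValue (x : ℕ → ℝ) (n i : ℕ) : ℝ :=
  n * deltaHat x (Finset.range n) - ((n : ℝ) - 1) * deltaHat x ((Finset.range n).erase i)

/-- The jackknife empirical likelihood ratio at `θ` of the sample `x 0, …, x (n - 1)`. The products
lie in `[0, 1]` and the feasible set is compact, so this is the maximum when there is a feasible
`p`, and it is `0` when there is none. -/
def jelRatio (x : ℕ → ℝ) (n : ℕ) (θ : ℝ) : ℝ :=
  sSup {r : ℝ | ∃ p : ℕ → ℝ, (∀ i ∈ Finset.range n, 0 ≤ p i) ∧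
    ∑ i ∈ Finset.range n, p i = 1 ∧
    ∑ i ∈ Finset.range n, p i * pseudoValue x n i = θ ∧
    r = ∏ i ∈ Finset.range n, (n * p i)}

/-- `-2 log R(θ)`, with the value `+∞` where `R(θ) = 0`. -/
def negTwoLogJEL (x : ℕ → ℝ) (n : ℕ) (θ : ℝ) : EReal :=
  ((-2 : ℝ) : EReal) * ENNReal.log (ENNReal.ofReal (jelRatio x n θ))

/-- The chi-squared distribution with one degree of freedom: the law of the square of a standard
normal variable. -/
def chiSquaredOne : Measure ℝ := (gaussianReal 0 1).map (fun z => z ^ 2)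

instance : IsProbabilityMeasure chiSquaredOne :=
  Measure.isProbabilityMeasure_map (by fun_prop)

end CauchyJEL

end

/-
The statistic is a U-statistic of order three whose kernel `orderedKern` is not symmetric: it is
evaluated at the observations in the order of their indices. Once the kernel is centred, the Hájek
projection of the U-statistic is a sum of independent bounded variables, and the remainder is an
average of terms which are orthogonal unless they share two observations, hence is negligible. The
same orthogonality shows that the pseudo-value of an observation is close to its projection, so that
the pseudo-values have asymptotically the mean of the U-statistic and the second moment `hajekVar`
of the projections.

Empirical likelihood only sees these two moments: a Lagrange multiplier bounds the ratio from above,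
explicit weights bound it from below, and `-2 log R` is squeezed to `n m ^ 2 / s`, where `m` and `s`
are the first two moments of the centred pseudo-values.

As the kernel is not symmetric, the projection of an observation depends on its position in the
sample. Those of the first and of the last observations are close to the projections of the kernel
on its first and on its last argument. The projection of `h` combines exactly these two, so if
`σ₁² > 0` then one of them is not constant, and a positive fraction of the sample keeps `hajekVar`
away from `0`.

For the Cauchy law the reflection `x ↦ -x` exchanges `orderedKern` and `1 - orderedKern` almost
surely, so the mean of the kernel is `1 / 2`.
-/

noncomputable section

open Finset Topology
open scoped BigOperators

namespace CauchyJEL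

section Expect

variable {ι Ω : Type*} [MeasurableSpace Ω] {P : Measure Ω} {s : Finset ι} {f : ι → Ω → ℝ}

lemma measurable_expect (hf : ∀ i ∈ s, Measurable (f i)) : Measurable fun ω => 𝔼 i ∈ s, f i ω := by
  simp only [expect_eq_sum_div_card]
  exact (Finset.measurable_fun_sum s hf).div_const _

lemma integrable_expect (hf : ∀ i ∈ s, Integrable (f i) P) :
    Integrable (fun ω => 𝔼 i ∈ s, f i ω) P := by
  simp only [expect_eq_sum_div_card]
  exact (integrable_finsetSum s hf).div_const _

lemma integral_expect (hf : ∀ i ∈ s, Integrable (f i) P) :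
    ∫ ω, 𝔼 i ∈ s, f i ω ∂P = 𝔼 i ∈ s, ∫ ω, f i ω ∂P := by
  simp only [expect_eq_sum_div_card]
  rw [integral_div, integral_finsetSum s hf]

lemma abs_expect_le_of_forall_abs_le {a : ι → ℝ} {C : ℝ} (hC : 0 ≤ C) (ha : ∀ i ∈ s, |a i| ≤ C) :
    |𝔼 i ∈ s, a i| ≤ C := by
  rcases s.eq_empty_or_nonempty with rfl | hs
  · simpa using hC
  · exact (abs_expect_le s a).trans (expect_le hs ha)

end Expect

section EmpiricalLikelihood

variable {ι : Type*} [Fintype ι] {z p : ι → ℝ}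

/-- The empirical likelihood ratio for the hypothesis that the mean of the observations `z` is `0`.
It is `0` if `0` is not in the convex hull of the observations. -/
def elRatio (z : ι → ℝ) : ℝ :=
  sSup {r | ∃ p ∈ stdSimplex ℝ ι, ∑ i, p i * z i = 0 ∧ r = ∏ i, (Fintype.card ι * p i)}

lemma exp_le_one_add {u : ℝ} (hu : |u| ≤ 1 / 2) :
    Real.exp (u - u ^ 2 / 2 - 2 * |u| ^ 3) ≤ 1 + u := by
  have hpos : 0 < 1 + u := by linarith [neg_abs_le u]
  have htaylor := Real.abs_log_sub_add_sum_range_le (x := -u) (by rw [abs_neg]; linarith) 2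
  have hrem : |(-u)| ^ (2 + 1) / (1 - |(-u)|) ≤ 2 * |u| ^ 3 := by
    rw [abs_neg, div_le_iff₀ (by linarith)]
    norm_num
    nlinarith [pow_nonneg (abs_nonneg u) 3]
  have hlow := (abs_le.1 (htaylor.trans hrem)).1
  simp only [sum_range_succ, sum_range_zero, sub_neg_eq_add] at hlow
  norm_num at hlow
  rw [← Real.le_log_iff_exp_le hpos]
  linarith

lemma exp_sum_sub_le_prod_one_add {u : ι → ℝ} {b : ℝ} (hb : b ≤ 1 / 2) (hu : ∀ i, |u i| ≤ b) :
    Real.exp (∑ i, u i - (1 / 2 + 2 * b) * ∑ i, u i ^ 2) ≤ ∏ i, (1 + u i) := by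
  rw [mul_sum, ← sum_sub_distrib, Real.exp_sum]
  refine prod_le_prod (fun i _ => (Real.exp_pos _).le) fun i _ => ?_
  refine le_trans (Real.exp_le_exp.2 ?_) (exp_le_one_add ((hu i).trans hb))
  have hcube : |u i| ^ 3 ≤ b * u i ^ 2 := by
    rw [← sq_abs (u i), pow_succ']
    exact mul_le_mul_of_nonneg_right (hu i) (by positivity)
  nlinarith

/-- Lagrangian duality: each multiplier `l` bounds the likelihood ratio of every feasible `p`. -/
lemma prod_card_mul_mul_prod_one_add_le_one (hp : p ∈ stdSimplex ℝ ι) (hmean : ∑ i, p i * z i = 0)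
    {l : ℝ} (hl : ∀ i, 0 ≤ 1 + l * z i) :
    (∏ i, (Fintype.card ι * p i)) * ∏ i, (1 + l * z i) ≤ 1 := by
  have hnonneg : ∀ i, 0 ≤ (Fintype.card ι : ℝ) * p i * (1 + l * z i) := fun i =>
    mul_nonneg (mul_nonneg (Nat.cast_nonneg _) (hp.1 i)) (hl i)
  have hsum : ∑ i, (Fintype.card ι * p i * (1 + l * z i) - 1) = 0 := by
    calc ∑ i, (Fintype.card ι * p i * (1 + l * z i) - 1)
        = Fintype.card ι * ∑ i, p i + Fintype.card ι * l * ∑ i, p i * z i - Fintype.card ι := by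
          simp only [mul_sum, ← sum_add_distrib, sum_sub_distrib, sum_const, card_univ,
            nsmul_eq_mul, mul_one]
          congr 1
          exact sum_congr rfl fun i _ => by ring
      _ = 0 := by rw [hp.2, hmean]; ring
  calc (∏ i, (Fintype.card ι * p i)) * ∏ i, (1 + l * z i)
      = ∏ i, (Fintype.card ι * p i * (1 + l * z i)) := prod_mul_distrib.symm
    _ ≤ ∏ i, Real.exp (Fintype.card ι * p i * (1 + l * z i) - 1) :=
        prod_le_prod (fun i _ => hnonneg i) fun i _ => by
          linarith [Real.add_one_le_exp (Fintype.card ι * p i * (1 + l * z i) - 1)]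
    _ = 1 := by rw [← Real.exp_sum, hsum, Real.exp_zero]

lemma prod_card_mul_le_one (hp : p ∈ stdSimplex ℝ ι) : ∏ i, (Fintype.card ι * p i) ≤ 1 := by
  simpa using prod_card_mul_mul_prod_one_add_le_one (z := 0) (l := 0) hp (by simp) (by simp)

lemma prod_card_mul_le_elRatio (hp : p ∈ stdSimplex ℝ ι) (hmean : ∑ i, p i * z i = 0) :
    ∏ i, (Fintype.card ι * p i) ≤ elRatio z := by
  refine le_csSup ⟨1, ?_⟩ ⟨p, hp, hmean, rfl⟩
  rintro r ⟨q, hq, -, rfl⟩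
  exact prod_card_mul_le_one hq

lemma elRatio_le_exp {B : ℝ} (hs : 0 < 𝔼 i, z i ^ 2) (hB : ∀ i, |z i| ≤ B)
    (hsmall : |𝔼 i, z i| * B / 𝔼 i, z i ^ 2 ≤ 1 / 2) :
    elRatio z ≤ Real.exp (-(Fintype.card ι * (𝔼 i, z i) ^ 2 / 𝔼 i, z i ^ 2) / 2 +
      2 * B * (Fintype.card ι * (𝔼 i, z i) ^ 2) * |𝔼 i, z i| / (𝔼 i, z i ^ 2) ^ 2) := by
  have hm := Fintype.card_mul_expect z
  have hsq := Fintype.card_mul_expect fun i => z i ^ 2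
  set m := 𝔼 i, z i
  set s := 𝔼 i, z i ^ 2
  have hu : ∀ i, |m / s * z i| ≤ |m| * B / s := fun i => by
    rw [abs_mul, abs_div, abs_of_pos hs, div_mul_eq_mul_div]
    gcongr
    exact hB i
  have hexp := exp_sum_sub_le_prod_one_add hsmall hu
  simp only [mul_pow, ← mul_sum, ← hm, ← hsq] at hexp
  refine Real.sSup_le ?_ (Real.exp_pos _).le
  rintro r ⟨p, hp, hmean, rfl⟩
  have hdual := prod_card_mul_mul_prod_one_add_le_one (l := m / s) hp hmean fun i => by
    linarith [neg_abs_le (m / s * z i), hu i]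
  have hle := (mul_le_mul_of_nonneg_left hexp
    (prod_nonneg fun i _ => mul_nonneg (Nat.cast_nonneg _) (hp.1 i))).trans hdual
  rw [← le_div_iff₀ (Real.exp_pos _), one_div, ← Real.exp_neg] at hle
  refine hle.trans (Real.exp_le_exp.2 (le_of_eq ?_))
  field_simp
  ring

/-- The bound comes from the feasible weights `(1 + a (z i - m)) / n` with `a = -m / (s - m ^ 2)`,
where `m` and `s` are the first two moments of `z`. -/
lemma exp_le_elRatio [Nonempty ι] {B : ℝ} (hs : 0 < 𝔼 i, z i ^ 2 - (𝔼 i, z i) ^ 2)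
    (hB : ∀ i, |z i - 𝔼 j, z j| ≤ B)
    (hsmall : |𝔼 i, z i| * B / (𝔼 i, z i ^ 2 - (𝔼 i, z i) ^ 2) ≤ 1 / 2) :
    Real.exp (-(Fintype.card ι * (𝔼 i, z i) ^ 2 / (𝔼 i, z i ^ 2 - (𝔼 i, z i) ^ 2)) / 2 -
      2 * B * (Fintype.card ι * (𝔼 i, z i) ^ 2) * |𝔼 i, z i| /
        (𝔼 i, z i ^ 2 - (𝔼 i, z i) ^ 2) ^ 2) ≤ elRatio z := by
  have hm := Fintype.card_mul_expect z
  have hsq := Fintype.card_mul_expect fun i => z i ^ 2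
  have hn : (0 : ℝ) < Fintype.card ι := by exact_mod_cast Fintype.card_pos
  set m := 𝔼 i, z i
  set A := 𝔼 i, z i ^ 2 - m ^ 2 with hA
  set a := -(m / A) with ha
  have hu : ∀ i, |a * (z i - m)| ≤ |m| * B / A := fun i => by
    rw [abs_mul, ha, abs_neg, abs_div, abs_of_pos hs, div_mul_eq_mul_div]
    gcongr
    exact hB i
  have hcentered : ∑ i, (z i - m) = 0 := by simp [sum_sub_distrib, ← hm]
  have hvariance : ∑ i, (z i - m) ^ 2 = Fintype.card ι * A := by
    simp only [sub_sq, sum_add_distrib, sum_sub_distrib, ← sum_mul, mul_assoc, ← mul_sum, ← hm,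
      ← hsq, hA, sum_const, card_univ, nsmul_eq_mul]
    ring
  have hmean : ∑ i, (1 + a * (z i - m)) / Fintype.card ι * z i = 0 := by
    calc ∑ i, (1 + a * (z i - m)) / Fintype.card ι * z i
        = (∑ i, z i + a * ∑ i, (z i - m) ^ 2 + a * m * ∑ i, (z i - m)) / Fintype.card ι := by
          rw [mul_sum, mul_sum, ← sum_add_distrib, ← sum_add_distrib, sum_div]
          exact sum_congr rfl fun i _ => by ring
      _ = 0 := by rw [hcentered, hvariance, ← hm, ha]; field_simp; ring
  have hle := prod_card_mul_le_elRatio (p := fun i => (1 + a * (z i - m)) / Fintype.card ι)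
    ⟨fun i => div_nonneg (by linarith [neg_abs_le (a * (z i - m)), hu i]) hn.le, by
      rw [← sum_div, sum_add_distrib, ← mul_sum, hcentered]; simp [hn.ne']⟩ hmean
  simp only [mul_div_cancel₀ _ hn.ne'] at hle
  refine le_trans (Real.exp_le_exp.2 (le_of_eq ?_))
    ((exp_sum_sub_le_prod_one_add hsmall hu).trans hle)
  simp only [mul_pow, ← mul_sum, hcentered, hvariance, ha]
  field_simp
  ring

lemma abs_div_sub_div_le {a v W : ℝ} (hv : 0 < v) (ha : v / 2 ≤ a) (hW : 0 ≤ W) :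
    |W / a - W / v| ≤ W / v * (2 * |a - v| / v) := by
  have ha0 : 0 < a := by linarith
  rw [show W / a - W / v = W / v * ((v - a) / a) by field_simp, abs_mul,
    abs_of_nonneg (by positivity : 0 ≤ W / v), abs_div, abs_sub_comm v, abs_of_pos ha0]
  gcongr ?_ * ?_
  rw [div_le_div_iff₀ ha0 hv]
  nlinarith [abs_nonneg (a - v)]

lemma div_sq_le_of_half_le {a v R : ℝ} (hv : 0 < v) (ha : v / 2 ≤ a) (hR : 0 ≤ R) :
    R / a ^ 2 ≤ 4 * R / v ^ 2 := by
  calc R / a ^ 2 ≤ R / (v / 2) ^ 2 := by gcongr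
    _ = 4 * R / v ^ 2 := by field_simp; ring

lemma elRatio_mem_Icc_exp [Nonempty ι] {B v : ℝ} (hv : 0 < v) (hB : ∀ i, |z i| ≤ B)
    (hsmall : (2 * |𝔼 i, z i ^ 2 - v| + 34 * B * |𝔼 i, z i|) / v ≤ 1 / 4) :
    elRatio z ∈ Set.Icc
      (Real.exp (-(Fintype.card ι * (𝔼 i, z i) ^ 2 / v / 2 *
        (1 + (2 * |𝔼 i, z i ^ 2 - v| + 34 * B * |𝔼 i, z i|) / v))))
      (Real.exp (-(Fintype.card ι * (𝔼 i, z i) ^ 2 / v / 2 *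
        (1 - (2 * |𝔼 i, z i ^ 2 - v| + 34 * B * |𝔼 i, z i|) / v)))) := by
  have hmB : |𝔼 i, z i| ≤ B :=
    (abs_expect_le univ z).trans (expect_le univ_nonempty fun i _ => hB i)
  have hupper := elRatio_le_exp (z := z) (B := B)
  have hlower := exp_le_elRatio (z := z) (B := 2 * B)
  set m := 𝔼 i, z i
  set s := 𝔼 i, z i ^ 2
  set W := (Fintype.card ι : ℝ) * m ^ 2
  set A := s - m ^ 2 with hA_def
  have hW : 0 ≤ W := by positivity
  have hBm : 0 ≤ B * |m| := mul_nonneg ((abs_nonneg m).trans hmB) (abs_nonneg m)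
  have hmsq : m ^ 2 ≤ B * |m| := by
    rw [← sq_abs, sq]
    exact mul_le_mul_of_nonneg_right hmB (abs_nonneg m)
  rw [div_le_iff₀ hv] at hsmall
  have hsv := abs_le.1 (le_refl |s - v|)
  have hA : v / 2 ≤ A := by linarith [abs_nonneg (s - v)]
  have hs : v / 2 ≤ s := by linarith [sq_nonneg m]
  have hA0 : 0 < A := by linarith
  have hs0 : 0 < s := by linarith
  specialize hupper hs0 hB (by rw [div_le_iff₀ hs0]; linarith [abs_nonneg (s - v)])
  specialize hlower hA0 (fun i => (abs_sub _ _).trans (by linarith [hB i]))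
    (by rw [div_le_iff₀ hA0]; linarith [abs_nonneg (s - v)])
  have hR : 0 ≤ B * W * |m| := by nlinarith
  have hmainA := (le_abs_self _).trans (abs_div_sub_div_le hv hA hW)
  have hmains := (neg_le_abs _).trans (abs_div_sub_div_le hv hs hW)
  have hremA := div_sq_le_of_half_le hv hA hR
  have hrems := div_sq_le_of_half_le hv hs hR
  have hAv : |A - v| ≤ |s - v| + B * |m| :=
    abs_le.2 ⟨by linarith, by linarith [sq_nonneg m]⟩
  have hWv : W / v * (2 * |A - v| / v) ≤ W / v * (2 * (|s - v| + B * |m|) / v) := by gcongr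
  have hWBm : 0 ≤ W / v * (B * |m| / v) := by positivity
  refine ⟨le_trans (Real.exp_le_exp.2 ?_) hlower, hupper.trans (Real.exp_le_exp.2 ?_)⟩
  · ring_nf at hmainA hremA hWv hWBm ⊢
    linarith
  · ring_nf at hmains hrems hWBm ⊢
    linarith

lemma mul_exp_neg_le_one (y : ℝ) : y * Real.exp (-y) ≤ 1 := by
  rw [Real.exp_neg, ← div_eq_mul_inv, div_le_one (Real.exp_pos y)]
  linarith [Real.add_one_le_exp y]

lemma abs_sub_exp_neg_le {r y e : ℝ} (hy : 0 ≤ y) (he : 0 ≤ e) (he' : e ≤ 1 / 4)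
    (hr : r ∈ Set.Icc (Real.exp (-(y * (1 + e)))) (Real.exp (-(y * (1 - e))))) :
    |r - Real.exp (-y)| ≤ 4 * e := by
  have htangent := Real.add_one_le_exp (-(y * e))
  have hlow : Real.exp (-y) - e * (y * Real.exp (-y)) ≤ r := by
    refine le_trans ?_ hr.1
    rw [show -(y * (1 + e)) = -y + -(y * e) by ring, Real.exp_add]
    nlinarith [Real.exp_pos (-y)]
  have hupp : r - e * (y * Real.exp (-(y * (1 - e)))) ≤ Real.exp (-y) := by
    rw [show Real.exp (-y) = Real.exp (-(y * (1 - e))) * Real.exp (-(y * e)) by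
      rw [← Real.exp_add]; ring_nf]
    nlinarith [Real.exp_pos (-(y * (1 - e))), hr.2]
  have hdecay : y * (1 - e) * Real.exp (-(y * (1 - e))) ≤ 1 := mul_exp_neg_le_one _
  have hdecay' : y * Real.exp (-(y * (1 - e))) ≤ 4 := by
    have : 0 ≤ y * Real.exp (-(y * (1 - e))) := by positivity
    nlinarith
  rw [abs_le]
  constructor <;> nlinarith [mul_exp_neg_le_one y]

lemma elRatio_nonneg (z : ι → ℝ) : 0 ≤ elRatio z := by
  refine Real.sSup_nonneg ?_
  rintro r ⟨p, hp, -, rfl⟩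
  exact prod_nonneg fun i _ => mul_nonneg (Nat.cast_nonneg _) (hp.1 i)

lemma elRatio_le_one (z : ι → ℝ) : elRatio z ≤ 1 := by
  refine Real.sSup_le ?_ zero_le_one
  rintro r ⟨p, hp, -, rfl⟩
  exact prod_card_mul_le_one hp

lemma abs_elRatio_sub_exp_le [Nonempty ι] {B v : ℝ} (hv : 0 < v) (hB : ∀ i, |z i| ≤ B) :
    |elRatio z - Real.exp (-(Fintype.card ι * (𝔼 i, z i) ^ 2 / v / 2))| ≤
      4 * ((2 * |𝔼 i, z i ^ 2 - v| + 34 * B * |𝔼 i, z i|) / v) := by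
  have hB0 : 0 ≤ B := (abs_nonneg _).trans (hB (Classical.arbitrary ι))
  rcases le_or_gt ((2 * |𝔼 i, z i ^ 2 - v| + 34 * B * |𝔼 i, z i|) / v) (1 / 4) with hsmall | hlarge
  · exact abs_sub_exp_neg_le (by positivity) (by positivity) hsmall
      (elRatio_mem_Icc_exp hv hB hsmall)
  · have hexp : Real.exp (-(Fintype.card ι * (𝔼 i, z i) ^ 2 / v / 2)) ≤ 1 :=
      Real.exp_le_one_iff.2 (neg_nonpos.2 (by positivity))
    rw [abs_le]
    constructor <;> linarith [elRatio_nonneg z, elRatio_le_one z, Real.exp_pos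
      (-(Fintype.card ι * (𝔼 i, z i) ^ 2 / v / 2))]

end EmpiricalLikelihood

section Measurability

variable {ι : Type*} [Fintype ι]

lemma le_elRatio_iff {z : ι → ℝ} {c : ℝ} (hc : 0 < c) :
    c ≤ elRatio z ↔ ∃ p ∈ stdSimplex ℝ ι, ∑ i, p i * z i = 0 ∧ c ≤ ∏ i, (Fintype.card ι * p i) := by
  refine ⟨fun hle => ?_, fun ⟨p, hp, hmean, hle⟩ => hle.trans (prod_card_mul_le_elRatio hp hmean)⟩
  set S := stdSimplex ℝ ι ∩ {p | ∑ i, p i * z i = 0}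
  have himage : {r | ∃ p ∈ stdSimplex ℝ ι, ∑ i, p i * z i = 0 ∧ r = ∏ i, (Fintype.card ι * p i)} =
      (fun p : ι → ℝ => ∏ i, (Fintype.card ι * p i)) '' S := by
    ext r
    simp [S, and_assoc, eq_comm]
  rw [elRatio, himage] at hle
  have hS : IsCompact S := (isCompact_stdSimplex ℝ ι).inter_right
    (isClosed_eq (by fun_prop) continuous_const)
  have hne : S.Nonempty := by
    by_contra! hempty
    rw [hempty, Set.image_empty, Real.sSup_empty] at hle
    exact hc.not_ge hle
  obtain ⟨p, hp, hmax⟩ := hS.exists_sSup_image_eq hne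
    (f := fun p : ι → ℝ => ∏ i, (Fintype.card ι * p i)) (by fun_prop)
  exact ⟨p, hp.1, hp.2, hmax ▸ hle⟩

lemma upperSemicontinuous_elRatio : UpperSemicontinuous (elRatio (ι := ι)) := by
  refine upperSemicontinuous_iff_isClosed_preimage.2 fun c => ?_
  rcases le_or_gt c 0 with hc | hc
  · convert isClosed_univ
    exact Set.eq_univ_of_forall fun z => hc.trans (elRatio_nonneg z)
  have : CompactSpace (stdSimplex ℝ ι) := isCompact_iff_compactSpace.1 (isCompact_stdSimplex ℝ ι)
  have hproj : elRatio ⁻¹' Set.Ici c = Prod.snd '' {q : stdSimplex ℝ ι × (ι → ℝ) |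
      ∑ i, (q.1 : ι → ℝ) i * q.2 i = 0 ∧ c ≤ ∏ i, (Fintype.card ι * (q.1 : ι → ℝ) i)} := by
    ext z
    simp only [Set.mem_preimage, Set.mem_Ici, le_elRatio_iff hc]
    exact ⟨fun ⟨p, hp, h⟩ => ⟨(⟨p, hp⟩, z), h, rfl⟩, fun ⟨q, h, hq⟩ => ⟨q.1, q.1.2, hq ▸ h⟩⟩
  have hcoord : ∀ i, Continuous fun q : stdSimplex ℝ ι × (ι → ℝ) => (q.1 : ι → ℝ) i := fun i =>
    (continuous_apply i).comp (continuous_subtype_val.comp continuous_fst)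
  rw [hproj]
  exact isClosedMap_snd_of_compactSpace _ <| (isClosed_eq
    (continuous_finsetSum _ fun i _ => (hcoord i).mul (by fun_prop)) continuous_const).and
    (isClosed_le continuous_const (continuous_finsetProd _ fun i _ => (hcoord i).const_mul _))

lemma measurable_elRatio : Measurable (elRatio (ι := ι)) :=
  upperSemicontinuous_elRatio.measurable

end Measurability

section CentralLimitTheorem

lemma norm_prod_sub_prod_le {ι : Type*} (s : Finset ι) {a b : ι → ℂ} (ha : ∀ i ∈ s, ‖a i‖ ≤ 1)
    (hb : ∀ i ∈ s, ‖b i‖ ≤ 1) : ‖∏ i ∈ s, a i - ∏ i ∈ s, b i‖ ≤ ∑ i ∈ s, ‖a i - b i‖ := by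
  classical
  induction s using Finset.induction_on with
  | empty => simp
  | insert i s hi ih =>
    rw [forall_mem_insert] at ha hb
    rw [prod_insert hi, prod_insert hi, sum_insert hi]
    have hprod : ‖∏ j ∈ s, a j‖ ≤ 1 := by
      rw [norm_prod]
      exact prod_le_one (fun _ _ => norm_nonneg _) ha.2
    calc ‖a i * ∏ j ∈ s, a j - b i * ∏ j ∈ s, b j‖
        = ‖(a i - b i) * ∏ j ∈ s, a j + b i * (∏ j ∈ s, a j - ∏ j ∈ s, b j)‖ := by ring_nf
      _ ≤ ‖a i - b i‖ * ‖∏ j ∈ s, a j‖ + ‖b i‖ * ‖∏ j ∈ s, a j - ∏ j ∈ s, b j‖ := by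
          rw [← norm_mul, ← norm_mul]
          exact norm_add_le _ _
      _ ≤ ‖a i - b i‖ * 1 + 1 * ∑ j ∈ s, ‖a j - b j‖ := by
          gcongr
          exacts [hb.1, ih ha.2 hb.2]
      _ = ‖a i - b i‖ + ∑ j ∈ s, ‖a j - b j‖ := by ring

lemma norm_exp_mul_I_sub_le {u : ℝ} (hu : |u| ≤ 1) :
    ‖Complex.exp (u * Complex.I) - (1 + u * Complex.I - (u : ℂ) ^ 2 / 2)‖ ≤ |u| ^ 3 := by
  have htaylor := Complex.exp_bound (x := u * Complex.I) (by simpa using hu) (n := 3) (by norm_num)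
  have hsum : ∑ m ∈ range 3, ((u : ℂ) * Complex.I) ^ m / (m.factorial : ℂ) =
      1 + u * Complex.I - (u : ℂ) ^ 2 / 2 := by
    simp [sum_range_succ, mul_pow, Nat.factorial]
    ring
  have hnorm : ‖(u : ℂ) * Complex.I‖ = |u| := by simp
  rw [hsum, hnorm] at htaylor
  refine htaylor.trans ?_
  norm_num [Nat.factorial]
  nlinarith [pow_nonneg (abs_nonneg u) 3]

section CharFun

variable {ν : Measure ℝ} [IsProbabilityMeasure ν] {c t : ℝ}

lemma integral_taylor_two (hc : ∀ᵐ x ∂ν, |x| ≤ c) (h0 : ∫ x, x ∂ν = 0) :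
    Integrable (fun x : ℝ => 1 + (t * x : ℝ) * Complex.I - ((t * x : ℝ) : ℂ) ^ 2 / 2) ν ∧
    ∫ x, (1 + (t * x : ℝ) * Complex.I - ((t * x : ℝ) : ℂ) ^ 2 / 2) ∂ν =
      1 - (((t ^ 2 * ∫ x, x ^ 2 ∂ν) / 2 : ℝ) : ℂ) := by
  have hx : Integrable (fun x : ℝ => x) ν := Integrable.of_bound (by fun_prop) c hc
  have hx2 : Integrable (fun x : ℝ => x ^ 2) ν := Integrable.of_bound (by fun_prop) (c ^ 2)
    (hc.mono fun x hx => by simpa using pow_le_pow_left₀ (abs_nonneg x) hx 2)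
  have hre : Integrable (fun x : ℝ => ((1 - t ^ 2 / 2 * x ^ 2 : ℝ) : ℂ)) ν :=
    ((integrable_const _).sub (hx2.const_mul _)).ofReal
  have him : Integrable (fun x : ℝ => ((t * x : ℝ) : ℂ) * Complex.I) ν :=
    ((hx.const_mul t).ofReal).mul_const _
  have hsplit : (fun x : ℝ => 1 + (t * x : ℝ) * Complex.I - ((t * x : ℝ) : ℂ) ^ 2 / 2) =
      fun x => ((1 - t ^ 2 / 2 * x ^ 2 : ℝ) : ℂ) + ((t * x : ℝ) : ℂ) * Complex.I := by
    funext x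
    push_cast
    ring
  rw [hsplit]
  refine ⟨hre.add him, ?_⟩
  rw [integral_add hre him, integral_mul_const, integral_complex_ofReal,
    integral_complex_ofReal, integral_sub (integrable_const _) (hx2.const_mul _),
    integral_const_mul, integral_const_mul, h0]
  simp
  ring

lemma norm_charFun_sub_one_sub_le (hc : ∀ᵐ x ∂ν, |x| ≤ c) (htc : |t| * c ≤ 1)
    (h0 : ∫ x, x ∂ν = 0) :
    ‖charFun ν t - (1 - (((t ^ 2 * ∫ x, x ^ 2 ∂ν) / 2 : ℝ) : ℂ))‖ ≤
      |t| ^ 3 * c * ∫ x, x ^ 2 ∂ν := by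
  obtain ⟨htaylor, hintegral⟩ := integral_taylor_two (t := t) hc h0
  have hexp : Integrable (fun x : ℝ => Complex.exp (t * x * Complex.I)) ν :=
    Integrable.of_bound (by fun_prop) 1 (ae_of_all _ fun x => by
      rw [← Complex.ofReal_mul, Complex.norm_exp_ofReal_mul_I])
  have hx2 : Integrable (fun x : ℝ => x ^ 2) ν := Integrable.of_bound (by fun_prop) (c ^ 2)
    (hc.mono fun x hx => by simpa using pow_le_pow_left₀ (abs_nonneg x) hx 2)
  rw [charFun_apply_real, ← hintegral, ← integral_sub hexp htaylor, ← integral_const_mul]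
  refine (norm_integral_le_integral_norm _).trans
    (integral_mono_ae (hexp.sub htaylor).norm (hx2.const_mul _) (hc.mono fun x hx => ?_))
  have htx : |t * x| ≤ 1 := by
    rw [abs_mul]
    exact (mul_le_mul_of_nonneg_left hx (abs_nonneg t)).trans htc
  beta_reduce
  rw [← Complex.ofReal_mul]
  refine (norm_exp_mul_I_sub_le htx).trans ?_
  rw [abs_mul, mul_pow, pow_succ |x| 2, sq_abs, mul_comm (x ^ 2), ← mul_assoc]
  gcongr

lemma norm_charFun_sub_exp_le (hc : ∀ᵐ x ∂ν, |x| ≤ c) (htc : |t| * c ≤ 1)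
    (h0 : ∫ x, x ∂ν = 0) :
    ‖charFun ν t - Complex.exp (-((t ^ 2 * ∫ x, x ^ 2 ∂ν) / 2 : ℝ))‖ ≤
      (|t| ^ 3 * c + t ^ 4 * c ^ 2) * ∫ x, x ^ 2 ∂ν := by
  have hcharFun := norm_charFun_sub_one_sub_le hc htc h0
  have hvar : ∫ x, x ^ 2 ∂ν ≤ c ^ 2 := by
    refine (integral_mono_of_nonneg (ae_of_all _ fun x => sq_nonneg x) (integrable_const (c ^ 2))
      (hc.mono fun x hx => ?_)).trans (by simp)
    simpa using pow_le_pow_left₀ (abs_nonneg x) hx 2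
  set v := ∫ x, x ^ 2 ∂ν
  have : 0 ≤ v := integral_nonneg fun x => sq_nonneg x
  have hc0 : 0 ≤ c := by
    obtain ⟨x, hx⟩ := hc.exists
    exact (abs_nonneg x).trans hx
  have htv : t ^ 2 * v ≤ 1 := by
    calc t ^ 2 * v ≤ |t| ^ 2 * c ^ 2 := by rw [sq_abs]; gcongr
      _ = (|t| * c) ^ 2 := (mul_pow _ _ _).symm
      _ ≤ 1 := pow_le_one₀ (by positivity) htc
  have hnorm : ‖((-(t ^ 2 * v / 2) : ℝ) : ℂ)‖ = t ^ 2 * v / 2 := by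
    rw [Complex.norm_real, norm_neg, Real.norm_of_nonneg (by positivity)]
  have hexp := Complex.norm_exp_sub_one_sub_id_le (x := ((-(t ^ 2 * v / 2) : ℝ) : ℂ))
    (by rw [hnorm]; linarith)
  rw [hnorm] at hexp
  push_cast at hexp hcharFun ⊢
  calc ‖charFun ν t - Complex.exp (-(t ^ 2 * v / 2))‖
      = ‖(charFun ν t - (1 - t ^ 2 * v / 2)) -
          (Complex.exp (-(t ^ 2 * v / 2)) - 1 - -(t ^ 2 * v / 2))‖ := by congr 1; ring
    _ ≤ |t| ^ 3 * c * v + (t ^ 2 * v / 2) ^ 2 := (norm_sub_le _ _).trans (add_le_add hcharFun hexp)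
    _ ≤ |t| ^ 3 * c * v + t ^ 4 * (c ^ 2 * v) := by
        have : (t ^ 2 * v / 2) ^ 2 = t ^ 4 * (v * v) / 4 := by ring
        have : t ^ 4 * (v * v) ≤ t ^ 4 * (c ^ 2 * v) := by gcongr
        have : 0 ≤ t ^ 4 * (v * v) := by positivity
        linarith
    _ = (|t| ^ 3 * c + t ^ 4 * c ^ 2) * v := by ring

end CharFun

variable {Ω : Type*} [MeasurableSpace Ω] {P : Measure Ω} [IsProbabilityMeasure P]

lemma norm_charFun_sum_sub_exp_le {ι : Type*} {s : Finset ι} {Y : ι → Ω → ℝ} {c t : ℝ}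
    (hY : ∀ i, Measurable (Y i)) (hindep : iIndepFun Y P) (h0 : ∀ i, ∫ ω, Y i ω ∂P = 0)
    (hc : ∀ i ∈ s, ∀ ω, |Y i ω| ≤ c) (htc : |t| * c ≤ 1)
    (hvar : ∑ i ∈ s, ∫ ω, Y i ω ^ 2 ∂P = 1) :
    ‖charFun (P.map fun ω => ∑ i ∈ s, Y i ω) t - charFun (gaussianReal 0 1) t‖ ≤
      |t| ^ 3 * c + t ^ 4 * c ^ 2 := by
  have hprob : ∀ i, IsProbabilityMeasure (P.map (Y i)) := fun i =>
    Measure.isProbabilityMeasure_map (hY i).aemeasurable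
  have hmoment : ∀ i (k : ℕ), ∫ x, x ^ k ∂P.map (Y i) = ∫ ω, Y i ω ^ k ∂P := fun i k =>
    integral_map (hY i).aemeasurable (by fun_prop)
  have hgaussian : charFun (gaussianReal 0 1) t =
      ∏ i ∈ s, Complex.exp (-((t ^ 2 * ∫ x, x ^ 2 ∂P.map (Y i)) / 2 : ℝ)) := by
    simp only [hmoment]
    rw [charFun_gaussianReal, ← Complex.exp_sum, sum_neg_distrib, ← Complex.ofReal_sum, ← sum_div,
      ← mul_sum, hvar]
    simp
  have hle_one : ∀ i, ‖Complex.exp (-((t ^ 2 * ∫ x, x ^ 2 ∂P.map (Y i)) / 2 : ℝ))‖ ≤ 1 := by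
    intro i
    rw [← Complex.ofReal_neg, Complex.norm_exp_ofReal, Real.exp_le_one_iff]
    have : 0 ≤ ∫ x, x ^ 2 ∂P.map (Y i) := integral_nonneg fun x => sq_nonneg x
    have : 0 ≤ t ^ 2 * ∫ x, x ^ 2 ∂P.map (Y i) := by positivity
    linarith
  have hterm : ∀ i ∈ s, ‖charFun (P.map (Y i)) t -
      Complex.exp (-((t ^ 2 * ∫ x, x ^ 2 ∂P.map (Y i)) / 2 : ℝ))‖ ≤
        (|t| ^ 3 * c + t ^ 4 * c ^ 2) * ∫ ω, Y i ω ^ 2 ∂P := by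
    intro i hi
    rw [← hmoment i 2]
    refine norm_charFun_sub_exp_le ?_ htc (by simpa [h0] using hmoment i 1)
    exact (ae_map_iff (hY i).aemeasurable (measurableSet_le (by fun_prop) (by fun_prop))).2
      (ae_of_all _ (hc i hi))
  rw [(hindep.restrict s).charFun_map_fun_finsetSum_eq_prod (fun i _ => (hY i).aemeasurable),
    hgaussian, Finset.prod_apply]
  refine (norm_prod_sub_prod_le s (fun i _ => norm_charFun_le_one t) fun i _ => hle_one i).trans ?_
  refine (sum_le_sum hterm).trans (le_of_eq ?_)
  rw [← mul_sum, hvar, mul_one]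

theorem tendstoInDistribution_sum_of_bounded {Y : ℕ → ℕ → Ω → ℝ} {c : ℕ → ℝ}
    (hY : ∀ n i, Measurable (Y n i)) (hindep : ∀ n, iIndepFun (Y n) P)
    (h0 : ∀ n i, ∫ ω, Y n i ω ∂P = 0) (hbound : ∀ᶠ n in atTop, ∀ i < n, ∀ ω, |Y n i ω| ≤ c n)
    (hc : Tendsto c atTop (𝓝 0))
    (hvar : ∀ᶠ n in atTop, ∑ i ∈ range n, ∫ ω, Y n i ω ^ 2 ∂P = 1) :
    TendstoInDistribution (fun n ω => ∑ i ∈ range n, Y n i ω) atTop (id : ℝ → ℝ)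
      (fun _ => P) (gaussianReal 0 1) where
  forall_aemeasurable n := (measurable_fun_sum _ fun i _ => hY n i).aemeasurable
  tendsto := by
    refine ProbabilityMeasure.tendsto_iff_tendsto_charFun.2 fun t => ?_
    simp only [ProbabilityMeasure.coe_mk, Measure.map_id]
    rw [tendsto_iff_norm_sub_tendsto_zero]
    have hlim : Tendsto (fun n => |t| ^ 3 * c n + t ^ 4 * c n ^ 2) atTop (𝓝 0) := by
      simpa using (hc.const_mul (|t| ^ 3)).add ((hc.pow 2).const_mul (t ^ 4))
    have htc : ∀ᶠ n in atTop, |t| * c n ≤ 1 := by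
      have : Tendsto (fun n => |t| * c n) atTop (𝓝 0) := by simpa using hc.const_mul |t|
      exact this.eventually (eventually_le_nhds one_pos)
    refine squeeze_zero' (Eventually.of_forall fun n => norm_nonneg _) ?_ hlim
    filter_upwards [hbound, hvar, htc] with n hb hv ht
    exact norm_charFun_sum_sub_exp_le (hY n) (hindep n) (h0 n)
      (fun i hi => hb i (mem_range.1 hi)) ht hv

end CentralLimitTheorem

section Wilks

/-- The value `-2 log r` of the likelihood ratio statistic, `⊤` for `r ≤ 0`. -/
def negTwoLog (r : ℝ) : EReal := ((-2 : ℝ) : EReal) * ENNReal.log (ENNReal.ofReal r)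

lemma continuous_negTwoLog : Continuous negTwoLog := by
  have hmul : Continuous fun y : EReal => ((-2 : ℝ) : EReal) * y :=
    continuous_iff_continuousAt.2 fun y =>
      (EReal.continuousAt_mul (p := (((-2 : ℝ) : EReal), y)) (.inl (by norm_cast; norm_num))
        (.inl (by norm_cast; norm_num)) (.inl (EReal.coe_ne_bot _))
        (.inl (EReal.coe_ne_top _))).comp (f := fun y : EReal => (((-2 : ℝ) : EReal), y))
        (by fun_prop)
  exact hmul.comp (ENNReal.continuous_log.comp ENNReal.continuous_ofReal)

lemma negTwoLog_exp (y : ℝ) : negTwoLog (Real.exp (-(y / 2))) = y := by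
  rw [negTwoLog, ENNReal.log_ofReal_of_pos (Real.exp_pos _), Real.log_exp, ← EReal.coe_mul]
  congr 1
  ring

variable {Ω : Type*} [MeasurableSpace Ω] {P : Measure Ω}

lemma tendstoInMeasure_zero_of_tendsto_integral_abs {f : ℕ → Ω → ℝ} (hf : ∀ n, Integrable (f n) P)
    (hlim : Tendsto (fun n => ∫ ω, |f n ω| ∂P) atTop (𝓝 0)) : TendstoInMeasure P f atTop 0 := by
  refine tendstoInMeasure_of_tendsto_eLpNorm one_ne_zero (fun n => (hf n).aestronglyMeasurable)
    aestronglyMeasurable_zero ?_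
  simpa only [sub_zero, eLpNorm_one_eq_lintegral_enorm, ← ofReal_integral_norm_eq_lintegral_enorm
    (hf _), Real.norm_eq_abs, ENNReal.ofReal_zero] using ENNReal.tendsto_ofReal hlim

variable [IsProbabilityMeasure P]

lemma tendsto_integral_abs_elRatio_sub_exp {z : ∀ n : ℕ, Fin n → Ω → ℝ} {v : ℕ → ℝ} {v₀ B : ℝ}
    (hz : ∀ n i, Measurable (z n i)) (hB : ∀ᶠ n in atTop, ∀ i ω, |z n i ω| ≤ B) (hv₀ : 0 < v₀)
    (hv : ∀ᶠ n in atTop, v₀ ≤ v n)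
    (hmean : Tendsto (fun n => ∫ ω, |𝔼 i, z n i ω| ∂P) atTop (𝓝 0))
    (hsq : Tendsto (fun n => ∫ ω, |𝔼 i, z n i ω ^ 2 - v n| ∂P) atTop (𝓝 0)) :
    Tendsto (fun n => ∫ ω, |elRatio (fun i => z n i ω) -
      Real.exp (-((√(n : ℝ) * (𝔼 i, z n i ω) / √(v n)) ^ 2 / 2))| ∂P) atTop (𝓝 0) := by
  have hlim := ((hsq.const_mul 2).add (hmean.const_mul (34 * B))).const_mul (4 / v₀)
  simp only [mul_zero, add_zero] at hlim
  refine squeeze_zero' (Eventually.of_forall fun n => integral_nonneg fun ω => abs_nonneg _) ?_ hlim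
  filter_upwards [hB, hv, eventually_gt_atTop 0] with n hBn hvn hn
  have : Nonempty (Fin n) := ⟨⟨0, hn⟩⟩
  have hvpos := hv₀.trans_le hvn
  have hB0 : 0 ≤ B := (abs_nonneg _).trans (hBn ⟨0, hn⟩ (Classical.choice P.nonempty_of_neZero))
  have hint : Integrable (fun ω => |𝔼 i, z n i ω|) P :=
    (integrable_expect fun i _ => .of_bound (hz n i).aestronglyMeasurable B
      (Eventually.of_forall (hBn i))).abs
  have hint' : Integrable (fun ω => |𝔼 i, z n i ω ^ 2 - v n|) P := by
    refine ((integrable_expect fun i _ => .of_bound ((hz n i).pow_const 2).aestronglyMeasurable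
      (B ^ 2) (Eventually.of_forall fun ω => ?_)).sub (integrable_const _)).abs
    rw [norm_pow, Real.norm_eq_abs]
    exact pow_le_pow_left₀ (abs_nonneg _) (hBn i ω) 2
  have hdom := ((hint'.const_mul 2).add (hint.const_mul (34 * B))).const_mul (4 / v₀)
  calc ∫ ω, |elRatio (fun i => z n i ω) -
        Real.exp (-((√(n : ℝ) * (𝔼 i, z n i ω) / √(v n)) ^ 2 / 2))| ∂P
      ≤ ∫ ω, 4 / v₀ * (2 * |𝔼 i, z n i ω ^ 2 - v n| + 34 * B * |𝔼 i, z n i ω|) ∂P := by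
        refine integral_mono_of_nonneg (Eventually.of_forall fun ω => abs_nonneg _) hdom
          (Eventually.of_forall fun ω => ?_)
        have hle := abs_elRatio_sub_exp_le (z := fun i => z n i ω) hvpos fun i => hBn i ω
        rw [Fintype.card_fin] at hle
        simp only [div_pow, mul_pow, Real.sq_sqrt n.cast_nonneg, Real.sq_sqrt hvpos.le,
          div_mul_eq_mul_div, mul_div_assoc] at hle ⊢
        refine hle.trans ?_
        gcongr
    _ = _ := by
        rw [integral_const_mul, integral_add (hint'.const_mul _) (hint.const_mul _),
          integral_const_mul, integral_const_mul]

theorem tendstoInDistribution_negTwoLog_elRatio {z : ∀ n : ℕ, Fin n → Ω → ℝ} {v : ℕ → ℝ} {v₀ B : ℝ}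
    (hz : ∀ n i, Measurable (z n i)) (hB : ∀ᶠ n in atTop, ∀ i ω, |z n i ω| ≤ B) (hv₀ : 0 < v₀)
    (hv : ∀ᶠ n in atTop, v₀ ≤ v n)
    (hclt : TendstoInDistribution (fun (n : ℕ) ω => √(n : ℝ) * (𝔼 i, z n i ω) / √(v n)) atTop
      (id : ℝ → ℝ) (fun _ => P) (gaussianReal 0 1))
    (hmean : Tendsto (fun n => ∫ ω, |𝔼 i, z n i ω| ∂P) atTop (𝓝 0))
    (hsq : Tendsto (fun n => ∫ ω, |𝔼 i, z n i ω ^ 2 - v n| ∂P) atTop (𝓝 0)) :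
    TendstoInDistribution (fun n ω => negTwoLog (elRatio fun i => z n i ω)) atTop
      (fun x : ℝ => (x : EReal)) (fun _ => P) chiSquaredOne := by
  have hratio_meas : ∀ n, Measurable fun ω => elRatio fun i => z n i ω := fun n =>
    measurable_elRatio.comp (measurable_pi_lambda _ (hz n))
  have hexp : TendstoInDistribution
      (fun (n : ℕ) ω => Real.exp (-((√(n : ℝ) * (𝔼 i, z n i ω) / √(v n)) ^ 2 / 2))) atTop
      (fun x : ℝ => Real.exp (-(x ^ 2 / 2))) (fun _ => P) (gaussianReal 0 1) :=
    hclt.continuous_comp (g := fun x => Real.exp (-(x ^ 2 / 2))) (by fun_prop)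
  have hratio : TendstoInDistribution (fun n ω => elRatio fun i => z n i ω) atTop
      (fun x : ℝ => Real.exp (-(x ^ 2 / 2))) (fun _ => P) (gaussianReal 0 1) := by
    refine tendstoInDistribution_of_tendstoInMeasure_sub _ _ hexp
      (tendstoInMeasure_zero_of_tendsto_integral_abs (fun n => ?_)
        (tendsto_integral_abs_elRatio_sub_exp hz hB hv₀ hv hmean hsq))
      fun n => (hratio_meas n).aemeasurable
    refine .sub (.of_bound (hratio_meas n).aestronglyMeasurable 1 (.of_forall fun ω => ?_))
      (.of_bound (hexp.forall_aemeasurable n).aestronglyMeasurable 1 (.of_forall fun ω => ?_))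
    · rw [Real.norm_of_nonneg (elRatio_nonneg _)]
      exact elRatio_le_one _
    · rw [Real.norm_of_nonneg (Real.exp_pos _).le]
      exact Real.exp_le_one_iff.2 (neg_nonpos.2 (by positivity))
  have hstat := hratio.continuous_comp continuous_negTwoLog
  refine ⟨hstat.forall_aemeasurable, by fun_prop, ?_⟩
  have hlaw : chiSquaredOne.map (fun x : ℝ => (x : EReal)) =
      (gaussianReal 0 1).map (negTwoLog ∘ fun x : ℝ => Real.exp (-(x ^ 2 / 2))) := by
    rw [chiSquaredOne, Measure.map_map (by fun_prop) (by fun_prop)]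
    congr 1
    ext x
    exact (negTwoLog_exp (x ^ 2)).symm
  simp only [hlaw]
  exact hstat.tendsto

end Wilks

section UStatistic

variable {α : Type*} {S : Finset α} {c : α} {r d : ℕ}

/-- The average of a kernel `φ` over the `r`-element subsets of `S`. -/
def uStat (r : ℕ) (φ : Finset α → ℝ) (S : Finset α) : ℝ := 𝔼 T ∈ S.powersetCard r, φ T

lemma abs_uStat_le {φ : Finset α → ℝ} {C : ℝ} (hC : 0 ≤ C) (hφ : ∀ T, |φ T| ≤ C) :
    |uStat r φ S| ≤ C :=
  abs_expect_le_of_forall_abs_le hC fun T _ => hφ T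

lemma choose_mul_uStat (r : ℕ) (φ : Finset α → ℝ) (S : Finset α) :
    (#S).choose r * uStat r φ S = ∑ T ∈ S.powersetCard r, φ T := by
  rw [← card_powersetCard, uStat, card_mul_expect]

lemma uStat_of_card_lt (φ : Finset α → ℝ) (hS : #S < r) : uStat r φ S = 0 := by
  rw [uStat, powersetCard_eq_empty.2 hS, expect_empty]

variable [DecidableEq α]

lemma card_filter_le_card_inter_le {T : Finset α} {m : ℕ} (hT : T ⊆ S) (hm : m ≤ r) :
    #{T' ∈ S.powersetCard r | m ≤ #(T ∩ T')} ≤ (#T).choose m * (#S - m).choose (r - m) := by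
  calc #{T' ∈ S.powersetCard r | m ≤ #(T ∩ T')}
      ≤ #((T.powersetCard m).biUnion fun W => {T' ∈ S.powersetCard r | W ⊆ T'}) := by
        refine card_le_card fun T' hT' => ?_
        obtain ⟨hT', hcard⟩ := mem_filter.1 hT'
        obtain ⟨W, hW, hWcard⟩ := exists_subset_card_eq hcard
        exact mem_biUnion.2 ⟨W, mem_powersetCard.2 ⟨hW.trans inter_subset_left, hWcard⟩,
          mem_filter.2 ⟨hT', hW.trans inter_subset_right⟩⟩
    _ ≤ (#T).choose m * (#S - m).choose (r - m) := by
        rw [← card_powersetCard]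
        refine card_biUnion_le_card_mul _ _ _ fun W hW => ?_
        obtain ⟨hWT, rfl⟩ := mem_powersetCard.1 hW
        exact (card_filter_powersetCard_subset W S r (hWT.trans hT) hm).le

lemma card_filter_le_card_inter_le_mul {T : Finset α} {m : ℕ} (hT : T ∈ S.powersetCard r)
    (hm : m ≤ r) : (#{T' ∈ S.powersetCard r | m ≤ #(T ∩ T')} : ℝ) ≤
      (r.choose m) ^ 2 / (#S).choose m * #(S.powersetCard r) := by
  obtain ⟨hTS, rfl⟩ := mem_powersetCard.1 hT
  have hpos : (0 : ℝ) < (#S).choose m :=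
    Nat.cast_pos.2 (Nat.choose_pos (hm.trans (card_le_card hTS)))
  have hchoose : ((#S).choose #T * (#T).choose m : ℝ) =
      (#S).choose m * (#S - m).choose (#T - m) := by
    exact_mod_cast Nat.choose_mul hm
  rw [card_powersetCard, div_mul_eq_mul_div, le_div_iff₀ hpos]
  calc (#{T' ∈ S.powersetCard #T | m ≤ #(T ∩ T')} : ℝ) * (#S).choose m
      ≤ ((#T).choose m * (#S - m).choose (#T - m) : ℕ) * (#S).choose m := by
        gcongr
        exact card_filter_le_card_inter_le hTS hm
    _ = (#T).choose m ^ 2 * (#S).choose #T := by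
        push_cast
        linear_combination -((#T).choose m : ℝ) * hchoose

lemma sum_powersetCard_succ (φ : Finset α → ℝ) (hc : c ∈ S) :
    ∑ T ∈ S.powersetCard (d + 1), φ T = ∑ T ∈ (S.erase c).powersetCard (d + 1), φ T +
      ∑ T ∈ (S.erase c).powersetCard d, φ (insert c T) := by
  have hnotMem : ∀ T ∈ (S.erase c).powersetCard d, c ∉ T := fun T hT hcT =>
    notMem_erase c S ((mem_powersetCard.1 hT).1 hcT)
  have hdisj : Disjoint ((S.erase c).powersetCard (d + 1))
      (((S.erase c).powersetCard d).image (insert c)) := by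
    refine disjoint_left.2 fun T hT hT' => ?_
    obtain ⟨T', -, rfl⟩ := mem_image.1 hT'
    exact notMem_erase c S ((mem_powersetCard.1 hT).1 (mem_insert_self c T'))
  conv_lhs => rw [← insert_erase hc]
  rw [powersetCard_succ_insert (notMem_erase c S), sum_union hdisj,
    sum_image fun T hT T' hT' h => ?_]
  rw [← erase_insert (hnotMem T hT), h, erase_insert (hnotMem T' hT')]

lemma card_mul_uStat_succ (φ : Finset α → ℝ) (hc : c ∈ S) :
    #S * uStat (d + 1) φ S = (#S - (d + 1)) * uStat (d + 1) φ (S.erase c) +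
      (d + 1) * uStat d (fun T => φ (insert c T)) (S.erase c) := by
  have hcard := card_erase_add_one hc
  rcases lt_or_ge #S (d + 1) with hlt | hle
  · rw [uStat_of_card_lt _ hlt, uStat_of_card_lt _ (by lia), uStat_of_card_lt _ (by lia)]
    simp
  have hpos : (0 : ℝ) < (#S).choose (d + 1) := Nat.cast_pos.2 (Nat.choose_pos hle)
  have hsum := sum_powersetCard_succ (d := d) φ hc
  rw [← choose_mul_uStat, ← choose_mul_uStat,
    ← choose_mul_uStat d fun T => φ (insert c T)] at hsum
  rw [← hcard] at hle hpos hsum ⊢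
  have hwith : ((#(S.erase c) + 1 : ℕ) * (#(S.erase c)).choose d : ℝ) =
      (#(S.erase c) + 1).choose (d + 1) * (d + 1) := by
    exact_mod_cast Nat.add_one_mul_choose_eq _ d
  have hwithout : ((#(S.erase c)).choose (d + 1) * (#(S.erase c) + 1 : ℕ) : ℝ) =
      (#(S.erase c) + 1).choose (d + 1) * ((#(S.erase c) + 1 : ℕ) - (d + 1)) := by
    have := congrArg (Nat.cast : ℕ → ℝ) (Nat.choose_mul_succ_eq #(S.erase c) (d + 1))
    rwa [Nat.cast_mul, Nat.cast_mul, Nat.cast_sub hle, Nat.cast_succ d] at this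
  refine mul_left_cancel₀ hpos.ne' ?_
  linear_combination (#(S.erase c) + 1 : ℕ) * hsum +
    uStat d (fun T => φ (insert c T)) (S.erase c) * hwith +
    uStat (d + 1) φ (S.erase c) * hwithout

lemma sum_powersetCard_succ_sum (f : Finset α → α → ℝ) :
    ∑ T ∈ S.powersetCard (d + 1), ∑ c ∈ T, f T c =
      ∑ c ∈ S, ∑ T ∈ (S.erase c).powersetCard d, f (insert c T) c := by
  rw [sum_sigma', sum_sigma']
  refine sum_bij' (fun p _ => ⟨p.2, p.1.erase p.2⟩) (fun q _ => ⟨insert q.1 q.2, q.1⟩)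
    ?_ ?_ ?_ ?_ ?_
  · rintro ⟨T, c⟩ h
    simp only [mem_sigma, mem_powersetCard] at h ⊢
    exact ⟨h.1.1 h.2, erase_subset_erase c h.1.1, by rw [card_erase_of_mem h.2, h.1.2]; rfl⟩
  · rintro ⟨c, T⟩ h
    simp only [mem_sigma, mem_powersetCard] at h ⊢
    have hcT : c ∉ T := fun hcT => notMem_erase c S (h.2.1 hcT)
    exact ⟨⟨insert_subset h.1 (h.2.1.trans (erase_subset c S)),
      by rw [card_insert_of_notMem hcT, h.2.2]⟩, mem_insert_self c T⟩
  · rintro ⟨T, c⟩ h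
    simp [insert_erase (mem_sigma.1 h).2]
  · rintro ⟨c, T⟩ h
    have hcT : c ∉ T := fun hcT =>
      notMem_erase c S ((mem_powersetCard.1 (mem_sigma.1 h).2).1 hcT)
    simp [erase_insert hcT]
  · rintro ⟨T, c⟩ h
    simp only [insert_erase (mem_sigma.1 h).2]

lemma uStat_succ_sum (f : Finset α → α → ℝ) :
    uStat (d + 1) (fun T => ∑ c ∈ T, f T c) S =
      (d + 1) * 𝔼 c ∈ S, uStat d (fun T => f (insert c T) c) (S.erase c) := by
  rcases lt_or_ge #S (d + 1) with hlt | hle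
  · rw [uStat_of_card_lt _ hlt, expect_eq_zero fun c hc => uStat_of_card_lt _ ?_, mul_zero]
    have := card_erase_add_one hc
    lia
  have hchoose : (#S * (#S - 1).choose d : ℝ) = (#S).choose (d + 1) * (d + 1) := by
    obtain ⟨n, hn⟩ := Nat.exists_eq_succ_of_ne_zero (show #S ≠ 0 by lia)
    rw [hn]
    exact_mod_cast Nat.add_one_mul_choose_eq n d
  have hpos : (0 : ℝ) < (#S).choose (d + 1) := Nat.cast_pos.2 (Nat.choose_pos hle)
  refine mul_left_cancel₀ hpos.ne' ?_
  rw [choose_mul_uStat, sum_powersetCard_succ_sum, ← mul_assoc, ← hchoose, mul_comm (#S : ℝ),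
    mul_assoc, card_mul_expect, mul_sum]
  refine sum_congr rfl fun c hc => ?_
  rw [← choose_mul_uStat, card_erase_of_mem hc]

/-- The jackknife pseudo-value at `c` of the U-statistic with kernel `φ`. -/
def jackknife (r : ℕ) (φ : Finset α → ℝ) (S : Finset α) (c : α) : ℝ :=
  #S * uStat r φ S - (#S - 1) * uStat r φ (S.erase c)

lemma jackknife_succ_eq (φ : Finset α → ℝ) (hc : c ∈ S) (hd : d + 1 < #S) :
    jackknife (d + 1) φ S c =
      (d + 1) * (#S - 1) / (#S - (d + 1)) * uStat d (fun T => φ (insert c T)) (S.erase c) -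
        #S * d / (#S - (d + 1)) * uStat (d + 1) φ S := by
  have hpos : (0 : ℝ) < #S - (d + 1) := sub_pos.2 (by exact_mod_cast hd)
  rw [jackknife]
  field_simp
  linear_combination (#S - 1) * card_mul_uStat_succ φ hc (d := d)

lemma expect_jackknife_succ (φ : Finset α → ℝ) (hd : d + 1 < #S) :
    𝔼 c ∈ S, jackknife (d + 1) φ S c = uStat (d + 1) φ S := by
  have hpos : (0 : ℝ) < #S - (d + 1) := sub_pos.2 (by exact_mod_cast hd)
  have hne : S.Nonempty := card_pos.1 (by lia)
  have hsum : (d + 1) * uStat (d + 1) φ S =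
      (d + 1) * 𝔼 c ∈ S, uStat d (fun T => φ (insert c T)) (S.erase c) := by
    rw [← uStat_succ_sum fun T _ => φ T, uStat, uStat, mul_expect]
    refine expect_congr rfl fun T hT => ?_
    simp [(mem_powersetCard.1 hT).2]
  rw [expect_congr rfl fun c hc => jackknife_succ_eq φ hc hd, expect_sub_distrib, ← mul_expect,
    expect_const hne]
  field_simp
  linear_combination -(#S - 1) * hsum

lemma abs_jackknife_succ_sub_le (φ : Finset α → ℝ) (hc : c ∈ S) (hS : 2 * (d + 1) ≤ #S) (l : ℝ) :
    |jackknife (d + 1) φ S c - (d + 1) * l| ≤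
      2 * (d + 1) * |uStat d (fun T => φ (insert c T)) (S.erase c) - l| +
        2 * (d + 1) * d / #S * |l| + 2 * d * |uStat (d + 1) φ S| := by
  have hS' : (2 * (d + 1) : ℝ) ≤ #S := by exact_mod_cast hS
  have hd : (0 : ℝ) ≤ d := Nat.cast_nonneg d
  have hpos : (0 : ℝ) < #S - (d + 1) := by linarith
  have hcard : (0 : ℝ) < #S := by linarith
  have hcoefD : |(d + 1) * (#S - 1) / (#S - (d + 1) : ℝ)| ≤ 2 * (d + 1) := by
    rw [abs_of_nonneg (div_nonneg (mul_nonneg (by positivity) (by linarith)) hpos.le),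
      div_le_iff₀ hpos]
    nlinarith
  have hcoefL : |(d + 1) * d / (#S - (d + 1) : ℝ)| ≤ 2 * (d + 1) * d / #S := by
    rw [abs_of_nonneg (by positivity), div_le_div_iff₀ hpos hcard]
    nlinarith [mul_nonneg (mul_nonneg hd (by linarith : (0 : ℝ) ≤ d + 1)) (sub_nonneg.2 hS')]
  have hcoefU : |#S * d / (#S - (d + 1) : ℝ)| ≤ 2 * d := by
    rw [abs_of_nonneg (by positivity), div_le_iff₀ hpos]
    nlinarith [mul_nonneg hd (sub_nonneg.2 hS')]
  have hdecomp : jackknife (d + 1) φ S c - (d + 1) * l =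
      (d + 1) * (#S - 1) / (#S - (d + 1)) * (uStat d (fun T => φ (insert c T)) (S.erase c) - l) +
        (d + 1) * d / (#S - (d + 1)) * l - #S * d / (#S - (d + 1)) * uStat (d + 1) φ S := by
    rw [jackknife_succ_eq φ hc (by lia)]
    field_simp
    ring
  rw [hdecomp]
  refine ((abs_sub _ _).trans (add_le_add_left (abs_add_le _ _) _)).trans ?_
  simp only [abs_mul _ l, abs_mul _ (uStat _ _ _), abs_mul _ (uStat _ _ _ - l)]
  gcongr

end UStatistic

section Orthogonality

variable {κ Ω : Type*} [MeasurableSpace Ω] {P : Measure Ω} [IsProbabilityMeasure P]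

lemma sq_integral_abs_le {f : Ω → ℝ} (hf : MemLp f 2 P) :
    (∫ ω, |f ω| ∂P) ^ 2 ≤ ∫ ω, f ω ^ 2 ∂P := by
  have hvar := variance_nonneg |f| P
  rw [variance_eq_sub hf.abs] at hvar
  simpa using hvar

lemma integral_abs_expect_le {A : Finset κ} {f : κ → Ω → ℝ} {C K : ℝ} {rel : κ → κ → Prop}
    [∀ a, DecidablePred (rel a)] (hC : 0 ≤ C) (hK : 0 ≤ K) (hf : ∀ a ∈ A, Measurable (f a))
    (hfC : ∀ a ∈ A, ∀ ω, |f a ω| ≤ C)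
    (horth : ∀ a ∈ A, ∀ b ∈ A, ¬ rel a b → ∫ ω, f a ω * f b ω ∂P = 0)
    (hcard : ∀ a ∈ A, (#{b ∈ A | rel a b} : ℝ) ≤ K * #A) :
    ∫ ω, |𝔼 a ∈ A, f a ω| ∂P ≤ C * √K := by
  have hint : ∀ a ∈ A, ∀ b ∈ A, Integrable (fun ω => f a ω * f b ω) P := fun a ha b hb => by
    refine .of_bound ((hf a ha).mul (hf b hb)).aestronglyMeasurable (C * C) (.of_forall fun ω => ?_)
    rw [norm_mul]
    exact mul_le_mul (hfC a ha ω) (hfC b hb ω) (abs_nonneg _) hC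
  have hrow : ∀ a ∈ A, 𝔼 b ∈ A, ∫ ω, f a ω * f b ω ∂P ≤ C ^ 2 * K := fun a ha => by
    have hpos : (0 : ℝ) < #A := Nat.cast_pos.2 (card_pos.2 ⟨a, ha⟩)
    calc 𝔼 b ∈ A, ∫ ω, f a ω * f b ω ∂P
        ≤ 𝔼 b ∈ A, if rel a b then C ^ 2 else 0 := expect_le_expect fun b hb => by
          split_ifs with hab
          · have hbound : ∀ ω, ‖f a ω * f b ω‖ ≤ C ^ 2 := fun ω => by
              rw [norm_mul, sq]
              exact mul_le_mul (hfC a ha ω) (hfC b hb ω) (abs_nonneg _) hC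
            simpa using (le_abs_self _).trans
              (norm_integral_le_of_norm_le_const (μ := P) (.of_forall hbound))
          · exact (horth a ha b hb hab).le
      _ = #{b ∈ A | rel a b} / #A * C ^ 2 := by
          rw [expect_eq_sum_div_card, ← sum_filter, sum_const, nsmul_eq_mul]
          ring
      _ ≤ C ^ 2 * K := by
          rw [mul_comm]
          gcongr
          exact (div_le_iff₀ hpos).2 (hcard a ha)
  have hL2 : MemLp (fun ω => 𝔼 a ∈ A, f a ω) 2 P :=
    .of_bound (measurable_expect hf).aestronglyMeasurable C (.of_forall fun ω =>
      abs_expect_le_of_forall_abs_le hC fun a ha => hfC a ha ω)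
  refine abs_le_of_sq_le_sq' ((sq_integral_abs_le hL2).trans ?_) (by positivity) |>.2
  calc ∫ ω, (𝔼 a ∈ A, f a ω) ^ 2 ∂P
      = 𝔼 a ∈ A, 𝔼 b ∈ A, ∫ ω, f a ω * f b ω ∂P := by
        simp only [sq, expect_mul_expect]
        rw [integral_expect fun a ha => integrable_expect (hint a ha)]
        exact expect_congr rfl fun a ha => integral_expect (hint a ha)
    _ ≤ C ^ 2 * K := by
        rcases A.eq_empty_or_nonempty with rfl | hA
        · simpa using by positivity
        · exact expect_le hA hrow
    _ = (C * √K) ^ 2 := by rw [mul_pow, Real.sq_sqrt hK]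

lemma integral_abs_uStat_le {α : Type*} [DecidableEq α] {φ : Finset α → Ω → ℝ} {S : Finset α}
    {r m : ℕ} {C : ℝ} (hC : 0 ≤ C) (hm : m ≤ r) (hφ : ∀ T ∈ S.powersetCard r, Measurable (φ T))
    (hφC : ∀ T ∈ S.powersetCard r, ∀ ω, |φ T ω| ≤ C)
    (horth : ∀ T ∈ S.powersetCard r, ∀ T' ∈ S.powersetCard r, #(T ∩ T') < m →
      ∫ ω, φ T ω * φ T' ω ∂P = 0) :
    ∫ ω, |uStat r (fun T => φ T ω) S| ∂P ≤ C * r.choose m / √((#S).choose m) := by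
  refine (integral_abs_expect_le (rel := fun T T' => m ≤ #(T ∩ T')) hC (by positivity)
    hφ hφC (fun T hT T' hT' h => horth T hT T' hT' (not_le.1 h))
    fun T hT => card_filter_le_card_inter_le_mul hT hm).trans_eq ?_
  rw [Real.sqrt_div (by positivity), Real.sqrt_sq (Nat.cast_nonneg _), mul_div_assoc]

end Orthogonality

section CoordProj

/-- The law of an independent family of random variables with common law `μ`, indexed by `ι`. -/
abbrev iidLaw (ι : Type*) {E : Type*} [MeasurableSpace E] (μ : Measure E) : Measure (ι → E) :=
  Measure.infinitePi fun _ => μ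

variable {ι E : Type*} [MeasurableSpace E] {μ : Measure E} {f g : (ι → E) → ℝ} {S T : Finset ι}
  {i j : ι} {C : ℝ}

section

variable [IsProbabilityMeasure μ]

lemma integral_comp_eval {p : E → ℝ} (hp : Measurable p) (i : ι) :
    ∫ x, p (x i) ∂iidLaw ι μ = ∫ z, p z ∂μ := by
  have heval := measurePreserving_eval_infinitePi (fun _ : ι => μ) i
  conv_rhs => rw [← heval.map_eq]
  exact (integral_map heval.measurable.aemeasurable hp.aestronglyMeasurable).symm

lemma measurePreserving_comp_of_injective {κ : Type*} {σ : κ → ι} (hσ : Function.Injective σ) :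
    MeasurePreserving (fun (x : ι → E) j => x (σ j)) (iidLaw ι μ) (iidLaw κ μ) :=
  ⟨by fun_prop, Measure.map_infinitePi_infinitePi_of_inj (P := fun _ => μ) hσ⟩

lemma integral_mul_of_disjoint (hST : Disjoint S T) (hfS : DependsOn f (S : Set ι))
    (hgT : DependsOn g (T : Set ι)) (hf : Measurable f) (hg : Measurable g) :
    ∫ x, f x * g x ∂iidLaw ι μ = (∫ x, f x ∂iidLaw ι μ) * ∫ x, g x ∂iidLaw ι μ := by
  classical
  obtain ⟨z⟩ := μ.nonempty_of_neZero
  have hfactor : ∀ {u : (ι → E) → ℝ} {W : Finset ι}, DependsOn u (W : Set ι) →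
      u = (fun y => u (Function.updateFinset (fun _ => z) W y)) ∘ fun x (i : W) => x i :=
    fun hu => funext fun x => hu fun i hi => by simp [Function.updateFinset, mem_coe.1 hi]
  have hindep : iIndepFun (fun i (x : ι → E) => x i) (iidLaw ι μ) :=
    iIndepFun_infinitePi (X := fun _ x => x) fun _ => measurable_id
  have hfg : IndepFun f g (iidLaw ι μ) := by
    rw [hfactor hfS, hfactor hgT]
    exact (hindep.indepFun_finset S T hST fun i => measurable_pi_apply i).comp
      (hf.comp measurable_updateFinset) (hg.comp measurable_updateFinset)
  exact hfg.integral_mul_eq_mul_integral hf.aestronglyMeasurable hg.aestronglyMeasurable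

lemma integral_abs_expect_comp_eval_sub_le {q : ι → E → ℝ} {B : ℝ} (hq : ∀ c, Measurable (q c))
    (hq_nonneg : ∀ c z, 0 ≤ q c z) (hq_le : ∀ c z, q c z ≤ B) (S : Finset ι) :
    ∫ x, |𝔼 c ∈ S, q c (x c) - 𝔼 c ∈ S, ∫ z, q c z ∂μ| ∂iidLaw ι μ ≤ B / √(#S) := by
  classical
  rcases S.eq_empty_or_nonempty with rfl | ⟨i, _⟩
  · simp
  obtain ⟨z₀⟩ := μ.nonempty_of_neZero
  have hint : ∀ c, Integrable (q c) μ := fun c =>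
    .of_bound (hq c).aestronglyMeasurable B (.of_forall fun z => by
      simpa only [Real.norm_of_nonneg (hq_nonneg c z)] using hq_le c z)
  set g : ι → (ι → E) → ℝ := fun c x => q c (x c) - ∫ z, q c z ∂μ
  have hgmeas : ∀ c, Measurable (g c) := fun c =>
    ((hq c).comp (measurable_pi_apply c)).sub_const _
  have hmean_nonneg : ∀ c, 0 ≤ ∫ z, q c z ∂μ := fun c => integral_nonneg (hq_nonneg c)
  have hmean_le : ∀ c, ∫ z, q c z ∂μ ≤ B := fun c => by
    simpa using integral_mono (hint c) (integrable_const _) (hq_le c)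
  have hgB : ∀ c x, |g c x| ≤ B := fun c x =>
    abs_sub_le_iff.2 ⟨by linarith [hq_le c (x c), hmean_nonneg c],
      by linarith [hq_nonneg c (x c), hmean_le c]⟩
  have hgmean : ∀ c, ∫ x, g c x ∂iidLaw ι μ = 0 := fun c => by
    rw [integral_comp_eval (p := fun y => q c y - ∫ z, q c z ∂μ) ((hq c).sub_const _) c,
      integral_sub (hint c) (integrable_const _)]
    simp
  have hgdep : ∀ c, DependsOn (g c) (({c} : Finset ι) : Set ι) := fun c x y hxy => by
    simp only [g, hxy c (mem_coe.2 (mem_singleton_self c))]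
  have horth : ∀ a b, a ≠ b → ∫ x, g a x * g b x ∂iidLaw ι μ = 0 := fun a b hab => by
    rw [integral_mul_of_disjoint (disjoint_singleton.2 hab) (hgdep a) (hgdep b) (hgmeas a)
      (hgmeas b), hgmean, zero_mul]
  have hcount : ∀ a ∈ S, (#{b ∈ S | a = b} : ℝ) ≤ (#S : ℝ)⁻¹ * #S := fun a ha => by
    rw [Finset.filter_eq, if_pos ha, card_singleton,
      inv_mul_cancel₀ (Nat.cast_ne_zero.2 (card_ne_zero_of_mem ha)), Nat.cast_one]
  have hbound := integral_abs_expect_le (rel := fun a b => a = b)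
    ((hq_nonneg i z₀).trans (hq_le i z₀)) (by positivity) (fun c _ => hgmeas c)
    (fun c _ => hgB c) (fun a _ b _ => horth a b) hcount
  rw [Real.sqrt_inv, ← div_eq_mul_inv] at hbound
  simpa only [g, expect_sub_distrib] using hbound

end

variable [DecidableEq ι]

/-- The projection of `f` on its `i`-th coordinate (the Hájek projection): all the coordinates
other than the `i`-th one are integrated out. -/
def coordProj (μ : Measure E) (f : (ι → E) → ℝ) (i : ι) (z : E) : ℝ :=
  ∫ x, f (Function.update x i z) ∂iidLaw ι μ

variable [IsProbabilityMeasure μ]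

lemma measurable_coordProj (hf : Measurable f) (i : ι) : Measurable (coordProj μ f i) := by
  have hjoint : Measurable fun q : E × (ι → E) => f (Function.update q.2 i q.1) :=
    hf.comp (measurable_update'.comp measurable_swap)
  exact hjoint.stronglyMeasurable.integral_prod_right'.measurable

lemma abs_coordProj_le (hfC : ∀ x, |f x| ≤ C) (i : ι) (z : E) : |coordProj μ f i z| ≤ C := by
  have hnorm : ∀ x : ι → E, ‖f (Function.update x i z)‖ ≤ C := fun x => hfC _
  simpa [coordProj] using norm_integral_le_of_norm_le_const (μ := iidLaw ι μ) (.of_forall hnorm)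

lemma coordProj_comp_eval_self {p : E → ℝ} (i : ι) (z : E) :
    coordProj μ (fun x : ι → E => p (x i)) i z = p z := by
  simp [coordProj]

lemma coordProj_comp_eval_of_ne {p : E → ℝ} (hp : Measurable p) (hij : i ≠ j) (z : E) :
    coordProj μ (fun x : ι → E => p (x i)) j z = ∫ z, p z ∂μ := by
  simp only [coordProj, Function.update_of_ne hij, integral_comp_eval hp]

lemma coordProj_comp_of_injective {κ : Type*} [DecidableEq κ] {σ : κ → ι}
    (hσ : Function.Injective σ) {k : (κ → E) → ℝ} (hk : Measurable k) (a : κ) (z : E) :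
    coordProj μ (fun x : ι → E => k fun j => x (σ j)) (σ a) z = coordProj μ k a z := by
  have hmp := measurePreserving_comp_of_injective (μ := μ) hσ
  have hupd : Measurable fun y => k (Function.update y a z) :=
    hk.comp (measurable_update'.comp measurable_prodMk_right)
  rw [coordProj, coordProj, ← hmp.map_eq,
    integral_map hmp.measurable.aemeasurable hupd.aestronglyMeasurable]
  exact congrArg (integral _) <| funext fun x => congrArg k <|
    Function.update_comp_eq_of_injective x hσ a z

lemma measurePreserving_update (i : ι) :
    MeasurePreserving (fun q : (ι → E) × E => Function.update q.1 i q.2)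
      ((iidLaw ι μ).prod μ) (iidLaw ι μ) := by
  refine ⟨measurable_update', Measure.eq_infinitePi _ fun s t ht => ?_⟩
  have hpre : (fun q : (ι → E) × E => Function.update q.1 i q.2) ⁻¹' (s : Set ι).pi t =
      ((s.erase i : Finset ι) : Set ι).pi t ×ˢ if i ∈ s then t i else Set.univ := by
    ext ⟨x, z⟩
    simp only [Set.mem_preimage, Set.mem_pi, mem_coe, Set.mem_prod, mem_erase,
      Function.update_apply]
    split_ifs with hi <;> grind
  rw [Measure.map_apply measurable_update' (.pi s.countable_toSet fun j _ => ht j), hpre,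
    Measure.prod_prod, Measure.infinitePi_pi _ fun j _ => ht j]
  split_ifs with hi
  · exact prod_erase_mul s _ hi
  · rw [erase_eq_of_notMem hi, measure_univ, mul_one]

lemma integral_eq_integral_coordProj (hf : Integrable f (iidLaw ι μ)) (i : ι) :
    ∫ x, f x ∂iidLaw ι μ = ∫ z, coordProj μ f i z ∂μ := by
  have hupd := measurePreserving_update (μ := μ) i
  rw [← hupd.map_eq, integral_map hupd.measurable.aemeasurable
      (by simpa only [hupd.map_eq] using hf.aestronglyMeasurable),
    integral_prod_symm (fun q => f (Function.update q.1 i q.2))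
      (hupd.integrable_comp_of_integrable hf)]
  rfl

lemma integral_mul_of_inter_subset_singleton (hST : S ∩ T ⊆ {i}) (hfS : DependsOn f (S : Set ι))
    (hgT : DependsOn g (T : Set ι)) (hf : Measurable f) (hg : Measurable g)
    (hfg : Integrable (fun x => f x * g x) (iidLaw ι μ)) :
    ∫ x, f x * g x ∂iidLaw ι μ = ∫ z, coordProj μ f i z * coordProj μ g i z ∂μ := by
  have hdisj : Disjoint (S.erase i) (T.erase i) := by
    rw [Finset.disjoint_left]
    intro j hjS hjT
    exact (mem_erase.1 hjS).1 <| mem_singleton.1 <|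
      hST (mem_inter.2 ⟨mem_of_mem_erase hjS, mem_of_mem_erase hjT⟩)
  rw [integral_eq_integral_coordProj hfg i]
  have hupd : ∀ z, Measurable fun x : ι → E => Function.update x i z := fun z =>
    measurable_update'.comp measurable_prodMk_right
  exact integral_congr_ae <| .of_forall fun z =>
    integral_mul_of_disjoint hdisj (hfS.update i z) (hgT.update i z) (hf.comp (hupd z))
      (hg.comp (hupd z))

lemma integrable_comp_update (hf : Measurable f) (hfC : ∀ x, |f x| ≤ C) (i : ι) (z : E) :
    Integrable (fun x => f (Function.update x i z)) (iidLaw ι μ) :=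
  .of_bound (hf.comp (measurable_update'.comp measurable_prodMk_right)).aestronglyMeasurable C
    (.of_forall fun _ => hfC _)

lemma integral_mul_eq_zero_of_coordProj_eq_zero (hST : S ∩ T ⊆ {i})
    (hfS : DependsOn f (S : Set ι)) (hgT : DependsOn g (T : Set ι)) (hf : Measurable f)
    (hg : Measurable g) (hfC : ∀ x, |f x| ≤ C) (hgC : ∀ x, |g x| ≤ C)
    (hproj : ∀ z, coordProj μ f i z = 0) : ∫ x, f x * g x ∂iidLaw ι μ = 0 := by
  have hint : Integrable (fun x => f x * g x) (iidLaw ι μ) := by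
    refine .of_bound (hf.mul hg).aestronglyMeasurable (C * C) (.of_forall fun x => ?_)
    rw [norm_mul]
    exact mul_le_mul (hfC x) (hgC x) (abs_nonneg _) ((abs_nonneg _).trans (hfC x))
  simp [integral_mul_of_inter_subset_singleton hST hfS hgT hf hg hint, hproj]

end CoordProj

section CenteredKernel

variable {ι E : Type*} [MeasurableSpace E] {μ : Measure E}

/-- A bounded measurable kernel of mean zero, indexed by finite sets of observations: `φ T x` is a
function of the `x i` with `i ∈ T` only. No symmetry is required, `φ T x` may depend on the order
of the observations. -/
structure IsCenteredKernel (μ : Measure E) (C : ℝ) (φ : Finset ι → (ι → E) → ℝ) : Prop where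
  measurable (T : Finset ι) : Measurable (φ T)
  dependsOn (T : Finset ι) : DependsOn (φ T) (T : Set ι)
  abs_le (T : Finset ι) (x : ι → E) : |φ T x| ≤ C
  integral_eq_zero (T : Finset ι) : ∫ x, φ T x ∂iidLaw ι μ = 0

variable [IsProbabilityMeasure μ] {φ : Finset ι → (ι → E) → ℝ} {S T : Finset ι} {c i : ι} {C : ℝ}
  {d : ℕ}

lemma IsCenteredKernel.nonneg (hφ : IsCenteredKernel μ C φ) : 0 ≤ C := by
  obtain ⟨x⟩ := (iidLaw ι μ).nonempty_of_neZero
  exact (abs_nonneg _).trans (hφ.abs_le ∅ x)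

lemma IsCenteredKernel.integrable (hφ : IsCenteredKernel μ C φ) (T : Finset ι) :
    Integrable (φ T) (iidLaw ι μ) :=
  .of_bound (hφ.measurable T).aestronglyMeasurable C (.of_forall (hφ.abs_le T))

lemma IsCenteredKernel.integral_abs_uStat_succ_le (hφ : IsCenteredKernel μ C φ) (S : Finset ι) :
    ∫ x, |uStat (d + 1) (fun T => φ T x) S| ∂iidLaw ι μ ≤ C * (d + 1) / √(#S) := by
  classical
  have horth : ∀ T T', #(T ∩ T') < 1 → ∫ x, φ T x * φ T' x ∂iidLaw ι μ = 0 := fun T T' h => by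
    rw [integral_mul_of_disjoint (disjoint_iff_inter_eq_empty.2 (card_eq_zero.1 (by lia)))
      (hφ.dependsOn T) (hφ.dependsOn T') (hφ.measurable T) (hφ.measurable T'),
      hφ.integral_eq_zero, zero_mul]
  simpa using integral_abs_uStat_le (S := S) (r := d + 1) hφ.nonneg (by lia)
    (fun T _ => hφ.measurable T) (fun T _ => hφ.abs_le T) fun T _ T' _ => horth T T'

variable [DecidableEq ι]

/-- The average, over the `(d + 1)`-element subsets of `S` through `c`, of the projections of the
kernel on the observation `c`. -/
def hajekProj (μ : Measure E) (d : ℕ) (φ : Finset ι → (ι → E) → ℝ) (S : Finset ι) (c : ι) (z : E) :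
    ℝ :=
  uStat d (fun T => coordProj μ (φ (insert c T)) c z) (S.erase c)

/-- The asymptotic variance of the jackknife pseudo-values: the average over `c ∈ S` of the second
moments of `(d + 1) * hajekProj μ d φ S c`. -/
def hajekVar (μ : Measure E) (d : ℕ) (φ : Finset ι → (ι → E) → ℝ) (S : Finset ι) : ℝ :=
  𝔼 c ∈ S, ∫ z, ((d + 1) * hajekProj μ d φ S c z) ^ 2 ∂μ

namespace IsCenteredKernel

lemma integral_coordProj (hφ : IsCenteredKernel μ C φ) (T : Finset ι) (c : ι) :
    ∫ z, coordProj μ (φ T) c z ∂μ = 0 := by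
  rw [← integral_eq_integral_coordProj (hφ.integrable T), hφ.integral_eq_zero]

lemma measurable_hajekProj (hφ : IsCenteredKernel μ C φ) (S : Finset ι) (c : ι) :
    Measurable (hajekProj μ d φ S c) :=
  measurable_expect fun T _ => measurable_coordProj (hφ.measurable (insert c T)) c

lemma abs_hajekProj_le (hφ : IsCenteredKernel μ C φ) (S : Finset ι) (c : ι) (z : E) :
    |hajekProj μ d φ S c z| ≤ C :=
  abs_uStat_le hφ.nonneg fun T => abs_coordProj_le (hφ.abs_le (insert c T)) c z

lemma integral_hajekProj (hφ : IsCenteredKernel μ C φ) (S : Finset ι) (c : ι) :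
    ∫ z, hajekProj μ d φ S c z ∂μ = 0 := by
  have hint : ∀ T, Integrable (coordProj μ (φ (insert c T)) c) μ := fun T =>
    .of_bound (measurable_coordProj (hφ.measurable _) c).aestronglyMeasurable C
      (.of_forall (abs_coordProj_le (hφ.abs_le _) c))
  simp only [hajekProj, uStat]
  rw [integral_expect fun T _ => hint T, expect_eq_zero fun T _ => hφ.integral_coordProj _ c]

/-- Subtracting from `φ (insert c T)` its projection on the observation `c` makes the terms indexed
by disjoint sets `T` orthogonal. -/
lemma integral_abs_uStat_insert_sub_hajekProj_le (hφ : IsCenteredKernel μ C φ) (hd : 1 ≤ d)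
    (S : Finset ι) (c : ι) :
    ∫ x, |uStat d (fun T => φ (insert c T) x) (S.erase c) - hajekProj μ d φ S c (x c)| ∂iidLaw ι μ
      ≤ 2 * C * d / √(#(S.erase c)) := by
  set p : Finset ι → E → ℝ := fun T => coordProj μ (φ (insert c T)) c
  have hp : ∀ T, Measurable (p T) := fun T => measurable_coordProj (hφ.measurable _) c
  set g : Finset ι → (ι → E) → ℝ := fun T x => φ (insert c T) x - p T (x c)
  have hgmeas : ∀ T, Measurable (g T) := fun T =>
    (hφ.measurable _).sub ((hp T).comp (measurable_pi_apply c))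
  have hgdep : ∀ T, DependsOn (g T) (insert c T : Finset ι) := fun T x y hxy => by
    simp only [g, hφ.dependsOn _ hxy, hxy c (mem_insert_self c T)]
  have hgC : ∀ T x, |g T x| ≤ 2 * C := fun T x => by
    linarith [abs_sub (φ (insert c T) x) (p T (x c)), hφ.abs_le (insert c T) x,
      abs_coordProj_le (μ := μ) (hφ.abs_le (insert c T)) c (x c)]
  have hgproj : ∀ T z, coordProj μ (g T) c z = 0 := fun T z => by
    simp only [coordProj, g, Function.update_self]
    rw [integral_sub (integrable_comp_update (hφ.measurable _) (hφ.abs_le _) c z)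
      (integrable_const _), integral_const, probReal_univ, one_smul]
    exact sub_self _
  have horth : ∀ T T', #(T ∩ T') < 1 → ∫ x, g T x * g T' x ∂iidLaw ι μ = 0 := fun T T' h => by
    have hinter : insert c T ∩ insert c T' ⊆ {c} := by
      rw [← insert_inter_distrib, card_eq_zero.1 (Nat.lt_one_iff.1 h)]
      rfl
    exact integral_mul_eq_zero_of_coordProj_eq_zero hinter (hgdep T) (hgdep T') (hgmeas T)
      (hgmeas T') (hgC T) (hgC T') (hgproj T)
  have hbound := integral_abs_uStat_le (S := S.erase c) (by linarith [hφ.nonneg]) hd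
    (fun T _ => hgmeas T) (fun T _ => hgC T) fun T _ T' _ => horth T T'
  simpa only [hajekProj, uStat, g, p, expect_sub_distrib, Nat.choose_one_right] using hbound

lemma coordProj_sub_sum_coordProj (hφ : IsCenteredKernel μ C φ) (hi : i ∈ T) (z : E) :
    coordProj μ (fun x => φ T x - ∑ j ∈ T, coordProj μ (φ T) j (x j)) i z = 0 := by
  have hp : ∀ j, Measurable fun x : ι → E => coordProj μ (φ T) j (x j) := fun j =>
    (measurable_coordProj (hφ.measurable T) j).comp (measurable_pi_apply j)
  have hint : ∀ j, Integrable (fun x => coordProj μ (φ T) j (Function.update x i z j))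
      (iidLaw ι μ) := fun j =>
    integrable_comp_update (hp j) (fun x => abs_coordProj_le (hφ.abs_le T) j (x j)) i z
  have hterm : ∀ j ∈ T, j ≠ i →
      ∫ x, coordProj μ (φ T) j (Function.update x i z j) ∂iidLaw ι μ = 0 := fun j _ hj =>
    (coordProj_comp_eval_of_ne (measurable_coordProj (hφ.measurable T) j) hj z).trans
      (hφ.integral_coordProj T j)
  rw [coordProj, integral_sub (integrable_comp_update (hφ.measurable T) (hφ.abs_le T) i z)
    (integrable_finsetSum T fun j _ => hint j), integral_finsetSum T fun j _ => hint j,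
    sum_eq_single_of_mem i hi hterm]
  exact sub_eq_zero.2 (coordProj_comp_eval_self (p := coordProj μ (φ T) i) i z).symm

/-- The remainder of the Hájek projection is degenerate of order two: the terms indexed by sets with
at most one common element are orthogonal. -/
lemma integral_abs_uStat_sub_expect_hajekProj_le (hφ : IsCenteredKernel μ C φ) (hd : 1 ≤ d)
    (S : Finset ι) :
    ∫ x, |uStat (d + 1) (fun T => φ T x) S - (d + 1) * 𝔼 c ∈ S, hajekProj μ d φ S c (x c)|
        ∂iidLaw ι μ ≤ (d + 2) * C * (d + 1).choose 2 / √((#S).choose 2) := by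
  set g : Finset ι → (ι → E) → ℝ := fun T x => φ T x - ∑ j ∈ T, coordProj μ (φ T) j (x j)
  have hgmeas : ∀ T, Measurable (g T) := fun T => (hφ.measurable T).sub <|
    Finset.measurable_sum T fun j _ =>
      (measurable_coordProj (hφ.measurable T) j).comp (measurable_pi_apply j)
  have hgdep : ∀ T, DependsOn (g T) (T : Set ι) := fun T x y hxy => by
    simp only [g, hφ.dependsOn T hxy]
    rw [sum_congr rfl fun j hj => by rw [hxy j hj]]
  have hgC : ∀ T ∈ S.powersetCard (d + 1), ∀ x, |g T x| ≤ (d + 2) * C := fun T hT x => by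
    have hsum : |∑ j ∈ T, coordProj μ (φ T) j (x j)| ≤ (d + 1 : ℕ) * C := by
      rw [← (mem_powersetCard.1 hT).2, ← nsmul_eq_mul]
      exact (abs_sum_le_sum_abs _ _).trans
        (sum_le_card_nsmul T _ C fun j _ => abs_coordProj_le (hφ.abs_le T) j (x j))
    push_cast at hsum
    linarith [abs_sub (φ T x) (∑ j ∈ T, coordProj μ (φ T) j (x j)), hφ.abs_le T x]
  have horth : ∀ T ∈ S.powersetCard (d + 1), ∀ T' ∈ S.powersetCard (d + 1), #(T ∩ T') < 2 →
      ∫ x, g T x * g T' x ∂iidLaw ι μ = 0 := fun T hT T' hT' h => by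
    obtain ⟨i, hi, hinter⟩ : ∃ i ∈ T, T ∩ T' ⊆ {i} := by
      rcases (T ∩ T').eq_empty_or_nonempty with hempty | ⟨i, hi⟩
      · obtain ⟨i, hi⟩ := card_pos.1 (d.succ_pos.trans_eq (mem_powersetCard.1 hT).2.symm)
        exact ⟨i, hi, by simp [hempty]⟩
      · exact ⟨i, mem_of_mem_inter_left hi, fun j hj =>
          mem_singleton.2 (card_le_one.1 (by lia) j hj i hi)⟩
    exact integral_mul_eq_zero_of_coordProj_eq_zero hinter (hgdep T) (hgdep T') (hgmeas T)
      (hgmeas T') (hgC T hT) (hgC T' hT') (hφ.coordProj_sub_sum_coordProj hi)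
  have hC : 0 ≤ (d + 2) * C := mul_nonneg (by positivity) hφ.nonneg
  have hbound := integral_abs_uStat_le hC (by lia : 2 ≤ d + 1) (fun T _ => hgmeas T) hgC horth
  refine (integral_congr_ae (.of_forall fun x => ?_)).trans_le hbound
  simp only [hajekProj]
  rw [← uStat_succ_sum fun T c => coordProj μ (φ T) c (x c)]
  simp only [uStat, g, expect_sub_distrib]

end IsCenteredKernel

end CenteredKernel

section JackknifePseudovalues

variable {ι E : Type*} [MeasurableSpace E] {μ : Measure E}
  {φ : Finset ι → (ι → E) → ℝ} {S : Finset ι} {c : ι} {C : ℝ} {d : ℕ}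

lemma IsCenteredKernel.measurable_uStat (hφ : IsCenteredKernel μ C φ) (r : ℕ) (S : Finset ι) :
    Measurable fun x => uStat r (fun T => φ T x) S :=
  measurable_expect fun T _ => hφ.measurable T

lemma IsCenteredKernel.integrable_uStat [IsProbabilityMeasure μ] (hφ : IsCenteredKernel μ C φ)
    (r : ℕ) (S : Finset ι) : Integrable (fun x => uStat r (fun T => φ T x) S) (iidLaw ι μ) :=
  .of_bound (hφ.measurable_uStat r S).aestronglyMeasurable C
    (.of_forall fun x => abs_uStat_le hφ.nonneg fun T => hφ.abs_le T x)

variable [DecidableEq ι]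

lemma IsCenteredKernel.measurable_jackknife (hφ : IsCenteredKernel μ C φ) (r : ℕ) (S : Finset ι)
    (c : ι) : Measurable fun x => jackknife r (fun T => φ T x) S c :=
  ((hφ.measurable_uStat r S).const_mul _).sub ((hφ.measurable_uStat r _).const_mul _)

variable [IsProbabilityMeasure μ]

namespace IsCenteredKernel

lemma measurable_hajekProj_comp_eval (hφ : IsCenteredKernel μ C φ) (S : Finset ι) (c : ι) :
    Measurable fun x : ι → E => hajekProj μ d φ S c (x c) :=
  (hφ.measurable_hajekProj S c).comp (measurable_pi_apply c)

lemma integrable_uStat_insert_sub_hajekProj (hφ : IsCenteredKernel μ C φ) (S : Finset ι) (c : ι) :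
    Integrable (fun x => uStat d (fun T => φ (insert c T) x) (S.erase c) -
      hajekProj μ d φ S c (x c)) (iidLaw ι μ) := by
  refine .of_bound ((measurable_expect fun T _ => hφ.measurable _).sub
    (hφ.measurable_hajekProj_comp_eval S c)).aestronglyMeasurable (C + C)
    (.of_forall fun x => (abs_sub _ _).trans ?_)
  exact add_le_add (abs_uStat_le hφ.nonneg fun T => hφ.abs_le _ x) (hφ.abs_hajekProj_le S c _)

lemma abs_jackknife_le (hφ : IsCenteredKernel μ C φ) (hc : c ∈ S) (hS : 2 * (d + 1) ≤ #S)
    (x : ι → E) : |jackknife (d + 1) (fun T => φ T x) S c| ≤ 4 * (d + 1) * C := by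
  have hD : |uStat d (fun T => φ (insert c T) x) (S.erase c)| ≤ C :=
    abs_uStat_le hφ.nonneg fun T => hφ.abs_le _ x
  have hU : |uStat (d + 1) (fun T => φ T x) S| ≤ C := abs_uStat_le hφ.nonneg fun T => hφ.abs_le T x
  have hC := hφ.nonneg
  have hbound := abs_jackknife_succ_sub_le (fun T => φ T x) hc hS 0
  simp only [mul_zero, sub_zero, abs_zero, add_zero] at hbound
  calc _ ≤ _ := hbound
    _ ≤ 2 * (d + 1) * C + 2 * d * C := by gcongr
    _ ≤ 4 * (d + 1) * C := by linarith

lemma integral_abs_jackknife_sub_hajekProj_le (hφ : IsCenteredKernel μ C φ) (hd : 1 ≤ d)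
    (hc : c ∈ S) (hS : 2 * (d + 1) ≤ #S) :
    ∫ x, |jackknife (d + 1) (fun T => φ T x) S c - (d + 1) * hajekProj μ d φ S c (x c)|
      ∂iidLaw ι μ ≤ 12 * (d + 1) * d * C / √(#S) := by
  have hC := hφ.nonneg
  have hn : (2 * (d + 1) : ℝ) ≤ #S := by exact_mod_cast hS
  have hcard : (0 : ℝ) < #S := by linarith [(Nat.cast_nonneg d : (0 : ℝ) ≤ d)]
  have hsqrt : √(#S) / 2 ≤ √(#(S.erase c)) := by
    refine Real.le_sqrt_of_sq_le ?_
    rw [div_pow, Real.sq_sqrt hcard.le, cast_card_erase_of_mem hc]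
    linarith [(Nat.cast_nonneg d : (0 : ℝ) ≤ d)]
  have hsqrt_le : √(#S) ≤ #S :=
    Real.sqrt_le_self_iff.2 (.inr (by linarith [(Nat.cast_nonneg d : (0 : ℝ) ≤ d)]))
  set D : (ι → E) → ℝ := fun x =>
    uStat d (fun T => φ (insert c T) x) (S.erase c) - hajekProj μ d φ S c (x c)
  set U : (ι → E) → ℝ := fun x => uStat (d + 1) (fun T => φ T x) S
  have hD : Integrable D (iidLaw ι μ) := hφ.integrable_uStat_insert_sub_hajekProj S c
  have hU : Integrable U (iidLaw ι μ) := hφ.integrable_uStat (d + 1) S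
  have hUD : Integrable (fun x => 2 * (d + 1) * |D x| + 2 * d * |U x|) (iidLaw ι μ) :=
    (hD.abs.const_mul _).add (hU.abs.const_mul _)
  calc ∫ x, |jackknife (d + 1) (fun T => φ T x) S c - (d + 1) * hajekProj μ d φ S c (x c)|
        ∂iidLaw ι μ
      ≤ ∫ x, (2 * (d + 1) * |D x| + 2 * d * |U x| + 2 * (d + 1) * d / #S * C) ∂iidLaw ι μ := by
        refine integral_mono_of_nonneg (.of_forall fun x => abs_nonneg _)
          (hUD.add (integrable_const _)) (.of_forall fun x => ?_)
        have hbound := abs_jackknife_succ_sub_le (fun T => φ T x) hc hS (hajekProj μ d φ S c (x c))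
        have hLC : 2 * (d + 1) * d / #S * |hajekProj μ d φ S c (x c)| ≤
            2 * (d + 1) * d / #S * C := by
          gcongr
          exact hφ.abs_hajekProj_le S c _
        linarith
    _ = 2 * (d + 1) * ∫ x, |D x| ∂iidLaw ι μ + 2 * d * ∫ x, |U x| ∂iidLaw ι μ +
          2 * (d + 1) * d / #S * C := by
        rw [integral_add hUD (integrable_const _), integral_add (hD.abs.const_mul _)
          (hU.abs.const_mul _), integral_const_mul, integral_const_mul]
        simp
    _ ≤ 2 * (d + 1) * (2 * C * d / (√(#S) / 2)) + 2 * d * (C * (d + 1) / √(#S)) +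
          2 * (d + 1) * d / √(#S) * C := by
        gcongr
        · exact (hφ.integral_abs_uStat_insert_sub_hajekProj_le hd S c).trans (by gcongr)
        · exact hφ.integral_abs_uStat_succ_le S
    _ = 12 * (d + 1) * d * C / √(#S) := by
        ring

lemma abs_succ_mul_hajekProj_le (hφ : IsCenteredKernel μ C φ) (S : Finset ι) (c : ι) (z : E) :
    |(d + 1) * hajekProj μ d φ S c z| ≤ (d + 1) * C := by
  rw [abs_mul, abs_of_nonneg (by positivity : (0 : ℝ) ≤ d + 1)]
  exact mul_le_mul_of_nonneg_left (hφ.abs_hajekProj_le S c z) (by positivity)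

lemma sq_succ_mul_hajekProj_le (hφ : IsCenteredKernel μ C φ) (S : Finset ι) (c : ι) (z : E) :
    ((d + 1) * hajekProj μ d φ S c z) ^ 2 ≤ ((d + 1) * C) ^ 2 :=
  sq_le_sq.2 ((hφ.abs_succ_mul_hajekProj_le S c z).trans (le_abs_self _))

lemma abs_sq_jackknife_sub_le (hφ : IsCenteredKernel μ C φ) (hc : c ∈ S) (hS : 2 * (d + 1) ≤ #S)
    (x : ι → E) :
    |jackknife (d + 1) (fun T => φ T x) S c ^ 2 - ((d + 1) * hajekProj μ d φ S c (x c)) ^ 2| ≤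
      5 * (d + 1) * C *
        |jackknife (d + 1) (fun T => φ T x) S c - (d + 1) * hajekProj μ d φ S c (x c)| := by
  rw [sq_sub_sq, abs_mul]
  gcongr
  refine (abs_add_le _ _).trans ?_
  linarith [hφ.abs_jackknife_le hc hS x, hφ.abs_succ_mul_hajekProj_le (d := d) S c (x c)]

lemma integrable_jackknife_sub_hajekProj (hφ : IsCenteredKernel μ C φ) (hc : c ∈ S)
    (hS : 2 * (d + 1) ≤ #S) :
    Integrable (fun x => jackknife (d + 1) (fun T => φ T x) S c -
      (d + 1) * hajekProj μ d φ S c (x c)) (iidLaw ι μ) :=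
  .of_bound ((hφ.measurable_jackknife (d + 1) S c).sub
      ((hφ.measurable_hajekProj_comp_eval S c).const_mul _)).aestronglyMeasurable
    (5 * (d + 1) * C) (.of_forall fun x => (abs_sub _ _).trans <| by
      linarith [hφ.abs_jackknife_le hc hS x, hφ.abs_succ_mul_hajekProj_le (d := d) S c (x c)])

lemma integrable_sq_hajekProj_comp_eval (hφ : IsCenteredKernel μ C φ) (S : Finset ι) (c : ι) :
    Integrable (fun x => ((d + 1) * hajekProj μ d φ S c (x c)) ^ 2) (iidLaw ι μ) :=
  .of_bound (((hφ.measurable_hajekProj_comp_eval S c).const_mul _).pow_const 2).aestronglyMeasurable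
    (((d + 1) * C) ^ 2) (.of_forall fun x => by
      rw [Real.norm_of_nonneg (sq_nonneg _)]
      exact hφ.sq_succ_mul_hajekProj_le S c (x c))

lemma integral_abs_expect_sq_jackknife_sub_hajekVar_le (hφ : IsCenteredKernel μ C φ) (hd : 1 ≤ d)
    (hS : 2 * (d + 1) ≤ #S) :
    ∫ x, |𝔼 c ∈ S, jackknife (d + 1) (fun T => φ T x) S c ^ 2 - hajekVar μ d φ S| ∂iidLaw ι μ ≤
      (60 * d + 1) * ((d + 1) * C) ^ 2 / √(#S) := by
  have hC := hφ.nonneg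
  have hne : S.Nonempty := card_pos.1 (by lia)
  set J : ι → (ι → E) → ℝ := fun c x => jackknife (d + 1) (fun T => φ T x) S c
  set H : ι → (ι → E) → ℝ := fun c x => (d + 1) * hajekProj μ d φ S c (x c)
  have hint : ∀ c ∈ S, Integrable (fun x => |J c x - H c x|) (iidLaw ι μ) := fun c hc =>
    (hφ.integrable_jackknife_sub_hajekProj hc hS).abs
  have hlln : ∫ x, |𝔼 c ∈ S, H c x ^ 2 - hajekVar μ d φ S| ∂iidLaw ι μ ≤
      ((d + 1) * C) ^ 2 / √(#S) :=
    integral_abs_expect_comp_eval_sub_le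
      (fun c => ((hφ.measurable_hajekProj S c).const_mul _).pow_const 2) (fun _ _ => sq_nonneg _)
      (hφ.sq_succ_mul_hajekProj_le S) S
  have hintH : Integrable (fun x => |𝔼 c ∈ S, H c x ^ 2 - hajekVar μ d φ S|) (iidLaw ι μ) :=
    ((integrable_expect fun c _ => hφ.integrable_sq_hajekProj_comp_eval S c).sub
      (integrable_const _)).abs
  calc ∫ x, |𝔼 c ∈ S, J c x ^ 2 - hajekVar μ d φ S| ∂iidLaw ι μ
      ≤ ∫ x, (5 * (d + 1) * C * 𝔼 c ∈ S, |J c x - H c x| +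
          |𝔼 c ∈ S, H c x ^ 2 - hajekVar μ d φ S|) ∂iidLaw ι μ := by
        refine integral_mono_of_nonneg (.of_forall fun x => abs_nonneg _)
          (((integrable_expect hint).const_mul _).add hintH) (.of_forall fun x => ?_)
        refine (abs_sub_le _ (𝔼 c ∈ S, H c x ^ 2) _).trans (add_le_add_left ?_ _)
        rw [← expect_sub_distrib, mul_expect]
        exact (abs_expect_le _ _).trans
          (expect_le_expect fun c hc => hφ.abs_sq_jackknife_sub_le hc hS x)
    _ = 5 * (d + 1) * C * 𝔼 c ∈ S, ∫ x, |J c x - H c x| ∂iidLaw ι μ +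
          ∫ x, |𝔼 c ∈ S, H c x ^ 2 - hajekVar μ d φ S| ∂iidLaw ι μ := by
        rw [integral_add ((integrable_expect hint).const_mul _) hintH, integral_const_mul,
          integral_expect hint]
    _ ≤ 5 * (d + 1) * C * (12 * (d + 1) * d * C / √(#S)) + ((d + 1) * C) ^ 2 / √(#S) := by
        gcongr
        exact expect_le hne fun c hc => hφ.integral_abs_jackknife_sub_hajekProj_le hd hc hS
    _ = (60 * d + 1) * ((d + 1) * C) ^ 2 / √(#S) := by
        ring

end IsCenteredKernel

end JackknifePseudovalues

section KernelLimit

lemma expect_univ_fin (n : ℕ) (f : ℕ → ℝ) : 𝔼 i : Fin n, f i = 𝔼 i ∈ range n, f i := by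
  simp only [expect_eq_sum_div_card, card_univ, Fintype.card_fin, card_range, Finset.sum_range]

lemma tendstoInDistribution_congr_eventually {Ω Ω' G : Type*} [MeasurableSpace Ω]
    [MeasurableSpace Ω'] [TopologicalSpace G] [MeasurableSpace G] [OpensMeasurableSpace G]
    {P : Measure Ω} [IsProbabilityMeasure P] {P' : Measure Ω'} [IsProbabilityMeasure P']
    {Y Y' : ℕ → Ω → G} {Z : Ω' → G}
    (hY : TendstoInDistribution Y atTop Z (fun _ => P) P') (hY' : ∀ n, AEMeasurable (Y' n) P)
    (hYY' : ∀ᶠ n in atTop, Y n = Y' n) : TendstoInDistribution Y' atTop Z (fun _ => P) P' where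
  forall_aemeasurable := hY'
  aemeasurable_limit := hY.aemeasurable_limit
  tendsto := hY.tendsto.congr' <| hYY'.mono fun _ hn => Subtype.ext (congrArg P.map hn)

variable {E : Type*} [MeasurableSpace E] {μ : Measure E} [IsProbabilityMeasure μ]
  {φ : Finset ℕ → (ℕ → E) → ℝ} {C v₀ : ℝ} {d : ℕ}

namespace IsCenteredKernel

theorem tendstoInDistribution_expect_hajekProj (hφ : IsCenteredKernel μ C φ) (hv₀ : 0 < v₀)
    (hv : ∀ᶠ n in atTop, v₀ ≤ hajekVar μ d φ (range n)) :
    TendstoInDistribution (fun (n : ℕ) (x : ℕ → E) => √(n : ℝ) *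
        ((d + 1) * 𝔼 c ∈ range n, hajekProj μ d φ (range n) c (x c)) /
          √(hajekVar μ d φ (range n))) atTop (id : ℝ → ℝ) (fun _ => iidLaw ℕ μ)
      (gaussianReal 0 1) := by
  set a : ℕ → ℝ := fun n => √(n : ℝ) * √(hajekVar μ d φ (range n))
  set Y : ℕ → ℕ → (ℕ → E) → ℝ := fun n i x => (d + 1) * hajekProj μ d φ (range n) i (x i) / a n
  have hmeas : ∀ n i, Measurable fun z => (d + 1) * hajekProj μ d φ (range n) i z / a n :=
    fun n i => ((hφ.measurable_hajekProj (range n) i).const_mul _).div_const _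
  have hsum : (fun (n : ℕ) (x : ℕ → E) => √(n : ℝ) *
      ((d + 1) * 𝔼 c ∈ range n, hajekProj μ d φ (range n) c (x c)) /
        √(hajekVar μ d φ (range n))) = fun n x => ∑ i ∈ range n, Y n i x := by
    funext n x
    simp only [Y, a]
    rw [expect_eq_sum_div_card, card_range, ← sum_div, ← mul_sum, mul_div_assoc', ← mul_div_assoc,
      mul_comm (√(n : ℝ)), mul_div_assoc, Real.sqrt_div_self, ← div_eq_mul_inv, div_div]
  rw [hsum]
  refine tendstoInDistribution_sum_of_bounded (c := fun n => (d + 1) * C / (√(n : ℝ) * √v₀))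
    (fun n i => (hmeas n i).comp (measurable_pi_apply i))
    (fun n => iIndepFun_infinitePi (X := fun i z => (d + 1) * hajekProj μ d φ (range n) i z / a n)
      (hmeas n)) (fun n i => ?_) ?_ ?_ ?_
  · rw [integral_comp_eval (hmeas n i), integral_div, integral_const_mul, hφ.integral_hajekProj,
      mul_zero, zero_div]
  · filter_upwards [hv, eventually_gt_atTop 0] with n hvn hn i _ x
    have hC := hφ.nonneg
    rw [abs_div, abs_of_nonneg (by positivity : 0 ≤ a n)]
    simp only [a]
    gcongr
    exact hφ.abs_succ_mul_hajekProj_le (range n) i (x i)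
  · exact tendsto_const_nhds.div_atTop (Tendsto.atTop_mul_const (Real.sqrt_pos.2 hv₀)
      (Real.tendsto_sqrt_atTop.comp tendsto_natCast_atTop_atTop))
  · filter_upwards [hv, eventually_gt_atTop 0] with n hvn hn
    have hpos : 0 < hajekVar μ d φ (range n) := hv₀.trans_le hvn
    have hn' : (0 : ℝ) < n := Nat.cast_pos.2 hn
    have hsq : ∀ i, ∫ x, Y n i x ^ 2 ∂iidLaw ℕ μ =
        (∫ z, ((d + 1) * hajekProj μ d φ (range n) i z) ^ 2 ∂μ) /
          (n * hajekVar μ d φ (range n)) := fun i => by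
      rw [integral_comp_eval ((hmeas n i).pow_const 2)]
      simp only [div_pow, integral_div, a, mul_pow, Real.sq_sqrt hn'.le, Real.sq_sqrt hpos.le]
    have havg : hajekVar μ d φ (range n) =
        (∑ i ∈ range n, ∫ z, ((d + 1) * hajekProj μ d φ (range n) i z) ^ 2 ∂μ) / n := by
      rw [hajekVar, expect_eq_sum_div_card, card_range]
    rw [sum_congr rfl fun i _ => hsq i, ← sum_div, ← div_div, ← havg, div_self hpos.ne']

lemma integrable_hajekProj_comp_eval (hφ : IsCenteredKernel μ C φ) (S : Finset ℕ) (c : ℕ) :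
    Integrable (fun x : ℕ → E => hajekProj μ d φ S c (x c)) (iidLaw ℕ μ) :=
  .of_bound (hφ.measurable_hajekProj_comp_eval S c).aestronglyMeasurable C
    (.of_forall fun x => hφ.abs_hajekProj_le S c (x c))

lemma tendsto_integral_abs_sqrt_mul_uStat_sub (hφ : IsCenteredKernel μ C φ) (hd : 1 ≤ d)
    (hv₀ : 0 < v₀) (hv : ∀ᶠ n in atTop, v₀ ≤ hajekVar μ d φ (range n)) :
    Tendsto (fun n : ℕ => ∫ x, |√(n : ℝ) * uStat (d + 1) (fun T => φ T x) (range n) /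
        √(hajekVar μ d φ (range n)) -
      √(n : ℝ) * ((d + 1) * 𝔼 c ∈ range n, hajekProj μ d φ (range n) c (x c)) /
        √(hajekVar μ d φ (range n))| ∂iidLaw ℕ μ) atTop (𝓝 0) := by
  set K : ℝ := (d + 2) * C * (d + 1).choose 2
  have hrate : Tendsto (fun n : ℕ => √(2 / (n - 1 : ℝ)) * K / √v₀) atTop (𝓝 0) := by
    have hinv : Tendsto (fun n : ℕ => (2 : ℝ) / (n - 1 : ℝ)) atTop (𝓝 0) :=
      tendsto_const_nhds.div_atTop
        (tendsto_atTop_add_const_right _ (-1) tendsto_natCast_atTop_atTop)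
    simpa using ((Real.continuous_sqrt.tendsto 0).comp hinv).mul_const K |>.div_const (√v₀)
  refine squeeze_zero' (.of_forall fun n => integral_nonneg fun x => abs_nonneg _) ?_ hrate
  filter_upwards [hv, eventually_gt_atTop 1] with n hvn hn
  have hn' : (0 : ℝ) < n - 1 := sub_pos.2 (Nat.one_lt_cast.2 hn)
  have hsqrt : √(n : ℝ) / √(n.choose 2) = √(2 / (n - 1 : ℝ)) := by
    rw [← Real.sqrt_div n.cast_nonneg, Nat.cast_choose_two]
    congr 1
    field_simp
  have hK : 0 ≤ K := by have := hφ.nonneg; positivity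
  have hbound := hφ.integral_abs_uStat_sub_expect_hajekProj_le hd (range n)
  rw [card_range] at hbound
  simp only [← sub_div, ← mul_sub, abs_div, abs_mul, abs_of_nonneg (Real.sqrt_nonneg _)]
  rw [integral_div, integral_const_mul]
  calc _ ≤ √(n : ℝ) * (K / √(n.choose 2)) / √v₀ := by gcongr
    _ = √(2 / (n - 1 : ℝ)) * K / √v₀ := by rw [← hsqrt]; ring

theorem tendstoInDistribution_uStat (hφ : IsCenteredKernel μ C φ) (hd : 1 ≤ d) (hv₀ : 0 < v₀)
    (hv : ∀ᶠ n in atTop, v₀ ≤ hajekVar μ d φ (range n)) :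
    TendstoInDistribution (fun (n : ℕ) (x : ℕ → E) =>
        √(n : ℝ) * uStat (d + 1) (fun T => φ T x) (range n) / √(hajekVar μ d φ (range n)))
      atTop (id : ℝ → ℝ) (fun _ => iidLaw ℕ μ) (gaussianReal 0 1) := by
  have hU : ∀ n : ℕ, Integrable (fun x => √(n : ℝ) * uStat (d + 1) (fun T => φ T x) (range n) /
      √(hajekVar μ d φ (range n))) (iidLaw ℕ μ) := fun n =>
    ((hφ.integrable_uStat (d + 1) (range n)).const_mul _).div_const _
  have hL : ∀ n : ℕ, Integrable (fun x => √(n : ℝ) *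
      ((d + 1) * 𝔼 c ∈ range n, hajekProj μ d φ (range n) c (x c)) /
        √(hajekVar μ d φ (range n))) (iidLaw ℕ μ) := fun n =>
    (((integrable_expect fun c _ => hφ.integrable_hajekProj_comp_eval (range n) c).const_mul
      _).const_mul _).div_const _
  exact tendstoInDistribution_of_tendstoInMeasure_sub _ _
    (hφ.tendstoInDistribution_expect_hajekProj hv₀ hv)
    (tendstoInMeasure_zero_of_tendsto_integral_abs (fun n => (hU n).sub (hL n))
      (hφ.tendsto_integral_abs_sqrt_mul_uStat_sub hd hv₀ hv)) fun n => (hU n).aemeasurable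

theorem tendstoInDistribution_negTwoLog_elRatio_jackknife (hφ : IsCenteredKernel μ C φ)
    (hd : 1 ≤ d) (hv₀ : 0 < v₀) (hv : ∀ᶠ n in atTop, v₀ ≤ hajekVar μ d φ (range n)) :
    TendstoInDistribution (fun n (x : ℕ → E) => negTwoLog (elRatio fun i : Fin n =>
        jackknife (d + 1) (fun T => φ T x) (range n) i)) atTop (fun y : ℝ => (y : EReal))
      (fun _ => iidLaw ℕ μ) chiSquaredOne := by
  have hlarge : ∀ᶠ n in atTop, 2 * (d + 1) ≤ #(range n) := by
    simpa only [card_range] using eventually_ge_atTop (2 * (d + 1))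
  have hmean : ∀ᶠ n : ℕ in atTop, ∀ x : ℕ → E,
      𝔼 i : Fin n, jackknife (d + 1) (fun T => φ T x) (range n) i =
        uStat (d + 1) (fun T => φ T x) (range n) := by
    filter_upwards [hlarge] with n hn x
    rw [expect_univ_fin, expect_jackknife_succ _ (by lia)]
  have hsqrt : Tendsto (fun n : ℕ => √(n : ℝ)) atTop atTop :=
    Real.tendsto_sqrt_atTop.comp tendsto_natCast_atTop_atTop
  refine tendstoInDistribution_negTwoLog_elRatio (B := 4 * (d + 1) * C)
    (fun n i => hφ.measurable_jackknife _ _ _) ?_ hv₀ hv ?_ ?_ ?_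
  · filter_upwards [hlarge] with n hn i x
    exact hφ.abs_jackknife_le (mem_range.2 i.2) hn x
  · refine tendstoInDistribution_congr_eventually (hφ.tendstoInDistribution_uStat hd hv₀ hv)
      (fun n => (((measurable_expect fun i _ =>
        hφ.measurable_jackknife _ _ _).const_mul _).div_const _).aemeasurable) ?_
    filter_upwards [hmean] with n hn
    simp only [hn]
  · refine squeeze_zero' (.of_forall fun n => integral_nonneg fun x => abs_nonneg _) ?_
      (tendsto_const_nhds.div_atTop (a := C * (d + 1)) hsqrt)
    filter_upwards [hmean] with n hn
    simpa only [hn, card_range] using hφ.integral_abs_uStat_succ_le (d := d) (range n)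
  · refine squeeze_zero' (.of_forall fun n => integral_nonneg fun x => abs_nonneg _) ?_
      (tendsto_const_nhds.div_atTop (a := (60 * d + 1) * ((d + 1) * C) ^ 2) hsqrt)
    filter_upwards [hlarge] with n hn
    simp only [fun x => expect_univ_fin n fun i =>
      jackknife (d + 1) (fun T => φ T x) (range n) i ^ 2]
    simpa only [card_range] using
      hφ.integral_abs_expect_sq_jackknife_sub_hajekVar_le hd hn

end IsCenteredKernel

end KernelLimit

section OrderedKernel

lemma abs_uStat_succ_sub_le_of_disjoint {α : Type*} [DecidableEq α] {φ : Finset α → ℝ}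
    {S G : Finset α} {q C : ℝ} {d : ℕ} (hφC : ∀ T, |φ T| ≤ C) (hqC : |q| ≤ C) (hS : d + 1 ≤ #S)
    (hφq : ∀ T ∈ S.powersetCard (d + 1), Disjoint T G → φ T = q) :
    |uStat (d + 1) φ S - q| ≤ 2 * C * ((d + 1) * (#(S ∩ G) / #S)) := by
  have hC : 0 ≤ C := (abs_nonneg q).trans hqC
  set g : α → ℝ := fun c => if c ∈ G then 1 else 0
  have hg : ∀ c, 0 ≤ g c := fun c => by dsimp only [g]; split_ifs <;> norm_num
  have hterm : ∀ T ∈ S.powersetCard (d + 1), |φ T - q| ≤ 2 * C * ∑ c ∈ T, g c := fun T hT => by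
    by_cases hTG : Disjoint T G
    · simpa [hφq T hT hTG] using mul_nonneg (by linarith) (sum_nonneg fun c _ => hg c)
    · obtain ⟨c, hcT, hcG⟩ := not_disjoint_iff.1 hTG
      have hone : 1 ≤ ∑ c ∈ T, g c := by
        simpa only [g, if_pos hcG] using single_le_sum (fun c _ => hg c) hcT
      nlinarith [abs_sub (φ T) q, hφC T]
  calc |uStat (d + 1) φ S - q|
      = |𝔼 T ∈ S.powersetCard (d + 1), (φ T - q)| := by
        rw [expect_sub_distrib, expect_const (powersetCard_nonempty.2 hS), uStat]
    _ ≤ 2 * C * uStat (d + 1) (fun T => ∑ c ∈ T, g c) S := by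
        rw [uStat, mul_expect]
        exact (abs_expect_le _ _).trans (expect_le_expect hterm)
    _ ≤ 2 * C * ((d + 1) * 𝔼 c ∈ S, g c) := by
        rw [uStat_succ_sum]
        gcongr with c
        exact (le_abs_self _).trans (abs_expect_le_of_forall_abs_le (hg c) fun _ _ =>
          (abs_of_nonneg (hg c)).le)
    _ = 2 * C * ((d + 1) * (#(S ∩ G) / #S)) := by
        rw [expect_eq_sum_div_card, sum_ite_mem, sum_const, nsmul_one]

lemma exists_pos_le_expect_of_sub_mul_le {a : ℕ → ℕ → ℝ} {w A : ℝ} (ha : ∀ n c, 0 ≤ a n c)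
    (hw : 0 < w) (h : ∀ᶠ n : ℕ in atTop, ∀ c < n, w - A * (c / (n - 1 : ℝ)) ≤ a n c) :
    ∃ v₀ > 0, ∀ᶠ n in atTop, v₀ ≤ 𝔼 c ∈ range n, a n c := by
  obtain ⟨N, hN⟩ := exists_nat_gt (max (2 * A / w) 0)
  obtain ⟨hNA, hN₀⟩ := max_lt_iff.1 hN
  rw [div_lt_iff₀ hw] at hNA
  have hNpos : 0 < N := Nat.cast_pos.1 hN₀
  refine ⟨w / (4 * N), by positivity, ?_⟩
  filter_upwards [h, eventually_ge_atTop N, eventually_gt_atTop 1] with n hn hNn hn1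
  have hn' : (0 : ℝ) < n - 1 := sub_pos.2 (Nat.one_lt_cast.2 hn1)
  have hn'' : (0 : ℝ) < n := by linarith
  have hhalf : ∀ c ∈ range (n / N), w / 2 ≤ a n c := fun c hc => by
    have hcN : N * c < n :=
      (Nat.mul_lt_mul_of_pos_left (mem_range.1 hc) hNpos).trans_le (Nat.mul_div_le n N)
    have hcN' : (N * c : ℝ) ≤ n - 1 := by
      rw [le_sub_iff_add_le]
      exact_mod_cast hcN
    have hAc : A * (c / (n - 1 : ℝ)) ≤ w / 2 := by
      rw [mul_div_assoc', div_le_iff₀ hn']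
      nlinarith [(Nat.cast_nonneg c : (0 : ℝ) ≤ c)]
    have hcn : c < n := by nlinarith
    linarith [hn c hcn]
  have hcount : (n : ℝ) ≤ 2 * N * (n / N : ℕ) := by
    have hlt := Nat.lt_mul_div_succ n hNpos
    have hone : N * 1 ≤ N * (n / N) := Nat.mul_le_mul_left N ((Nat.one_le_div_iff hNpos).2 hNn)
    exact_mod_cast (by lia : n ≤ 2 * N * (n / N))
  rw [expect_eq_sum_div_card, card_range, le_div_iff₀ hn'']
  calc w / (4 * N) * n ≤ w / (4 * N) * (2 * N * (n / N : ℕ)) := by gcongr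
    _ = ∑ c ∈ range (n / N), w / 2 := by
        rw [sum_const, card_range, nsmul_eq_mul]
        field_simp
        ring
    _ ≤ ∑ c ∈ range (n / N), a n c := sum_le_sum hhalf
    _ ≤ ∑ c ∈ range n, a n c :=
        sum_le_sum_of_subset_of_nonneg (range_subset_range.2 (Nat.div_le_self n N))
          fun c _ _ => ha n c

lemma sq_le_sq_add_of_abs_sub_le {a b C δ : ℝ} (ha : |a| ≤ C) (hb : |b| ≤ C) (hab : |a - b| ≤ δ) :
    b ^ 2 ≤ a ^ 2 + 2 * C * δ := by
  have hsum : |a + b| ≤ 2 * C := (abs_add_le a b).trans (by linarith)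
  rw [← sub_le_iff_le_add']
  calc b ^ 2 - a ^ 2 ≤ |(a + b) * (a - b)| := by
        rw [← sq_sub_sq, abs_sub_comm]
        exact le_abs_self _
    _ ≤ 2 * C * δ := by
        rw [abs_mul]
        gcongr
        exact (abs_nonneg _).trans hsum

section HajekVar

variable {E : Type*} [MeasurableSpace E] {μ : Measure E} [IsProbabilityMeasure μ]
  {C : ℝ} {d : ℕ} {q : E → ℝ}

namespace IsCenteredKernel

lemma sub_le_integral_sq_hajekProj {ι : Type*} [DecidableEq ι] {φ : Finset ι → (ι → E) → ℝ}
    {S G : Finset ι} {c : ι} (hφ : IsCenteredKernel μ C φ) (hd : 1 ≤ d) (hq : Measurable q)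
    (hqC : ∀ z, |q z| ≤ C) (hS : d ≤ #(S.erase c))
    (hφq : ∀ T ∈ (S.erase c).powersetCard d, Disjoint T G →
      ∀ z, coordProj μ (φ (insert c T)) c z = q z) :
    ∫ z, q z ^ 2 ∂μ - 4 * C ^ 2 * d * (#(S.erase c ∩ G) / #(S.erase c)) ≤
      ∫ z, ((d + 1) * hajekProj μ d φ S c z) ^ 2 ∂μ := by
  obtain ⟨e, rfl⟩ := Nat.exists_eq_add_of_le' hd
  set L := hajekProj μ (e + 1) φ S c
  have hL : Integrable (fun z => (((e + 1 : ℕ) + 1) * L z) ^ 2) μ :=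
    .of_bound (((hφ.measurable_hajekProj S c).const_mul _).pow_const 2).aestronglyMeasurable _
      (.of_forall fun z => (Real.norm_of_nonneg (sq_nonneg _)).trans_le
        (hφ.sq_succ_mul_hajekProj_le S c z))
  have hq2 : Integrable (fun z => q z ^ 2) μ :=
    .of_bound (hq.pow_const 2).aestronglyMeasurable (C ^ 2) (.of_forall fun z => by
      simpa only [Real.norm_of_nonneg (sq_nonneg _), sq_abs] using
        pow_le_pow_left₀ (abs_nonneg _) (hqC z) 2)
  rw [sub_le_iff_le_add]
  calc ∫ z, q z ^ 2 ∂μ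
      ≤ ∫ z, ((((e + 1 : ℕ) + 1) * L z) ^ 2 +
          4 * C ^ 2 * (e + 1 : ℕ) * (#(S.erase c ∩ G) / #(S.erase c))) ∂μ := by
        refine integral_mono hq2 (hL.add (integrable_const _)) fun z => ?_
        have hclose : |L z - q z| ≤ 2 * C * ((e + 1) * (#(S.erase c ∩ G) / #(S.erase c))) :=
          abs_uStat_succ_sub_le_of_disjoint (fun T => abs_coordProj_le (hφ.abs_le _) c z) (hqC z)
            hS fun T hT hTG => hφq T hT hTG z
        have hsq := sq_le_sq_add_of_abs_sub_le (hφ.abs_hajekProj_le S c z) (hqC z) hclose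
        have hL2 : L z ^ 2 ≤ (((e + 1 : ℕ) + 1) * L z) ^ 2 := by
          rw [mul_pow]
          exact le_mul_of_one_le_left (sq_nonneg _) <| one_le_pow₀ <| by
            simp only [Nat.cast_add, Nat.cast_one, le_add_iff_nonneg_left]
            positivity
        push_cast at hL2 ⊢
        linarith
    _ = _ := by
        rw [integral_add hL (integrable_const _)]
        simp

variable {φ : Finset ℕ → (ℕ → E) → ℝ}

lemma exists_pos_le_hajekVar_of_forall_gt (hφ : IsCenteredKernel μ C φ) (hd : 1 ≤ d)
    (hq : Measurable q) (hqC : ∀ z, |q z| ≤ C) (hpos : 0 < ∫ z, q z ^ 2 ∂μ)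
    (hφq : ∀ c T, #T = d → (∀ j ∈ T, c < j) → ∀ z, coordProj μ (φ (insert c T)) c z = q z) :
    ∃ v₀ > 0, ∀ᶠ n in atTop, v₀ ≤ hajekVar μ d φ (range n) := by
  refine exists_pos_le_expect_of_sub_mul_le (A := 4 * C ^ 2 * d)
    (fun n c => integral_nonneg fun z => sq_nonneg _) hpos ?_
  filter_upwards [eventually_gt_atTop d] with n hn c hc
  have hcard : #((range n).erase c) = n - 1 := by
    rw [card_erase_of_mem (mem_range.2 hc), card_range]
  have hinter : (range n).erase c ∩ range c = range c := by grind
  have hbound := hφ.sub_le_integral_sq_hajekProj (S := range n) (G := range c) (c := c) hd hq hqC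
    (by lia) fun T hT hTc z => hφq c T (mem_powersetCard.1 hT).2 (fun j hj => ?_) z
  · rwa [hinter, card_range, hcard, Nat.cast_pred (by lia)] at hbound
  · have hjc : j ≠ c := ne_of_mem_erase ((mem_powersetCard.1 hT).1 hj)
    have hj' := disjoint_left.1 hTc hj
    rw [mem_range] at hj'
    lia

lemma exists_pos_le_hajekVar_of_forall_lt (hφ : IsCenteredKernel μ C φ) (hd : 1 ≤ d)
    (hq : Measurable q) (hqC : ∀ z, |q z| ≤ C) (hpos : 0 < ∫ z, q z ^ 2 ∂μ)
    (hφq : ∀ c T, #T = d → (∀ j ∈ T, j < c) → ∀ z, coordProj μ (φ (insert c T)) c z = q z) :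
    ∃ v₀ > 0, ∀ᶠ n in atTop, v₀ ≤ hajekVar μ d φ (range n) := by
  have hreflect : ∀ n, hajekVar μ d φ (range n) =
      𝔼 c ∈ range n, ∫ z, ((d + 1) * hajekProj μ d φ (range n) (n - 1 - c) z) ^ 2 ∂μ := fun n => by
    rw [hajekVar, expect_eq_sum_div_card, expect_eq_sum_div_card, ← sum_range_reflect]
  simp only [hreflect]
  refine exists_pos_le_expect_of_sub_mul_le (A := 4 * C ^ 2 * d)
    (fun n c => integral_nonneg fun z => sq_nonneg _) hpos ?_
  filter_upwards [eventually_gt_atTop d] with n hn c hc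
  have hcard : #((range n).erase (n - 1 - c)) = n - 1 := by
    rw [card_erase_of_mem (mem_range.2 (by lia)), card_range]
  have hcardIoo : #(Ioo (n - 1 - c) n) = c := by
    rw [Nat.card_Ioo]
    lia
  have hinter : (range n).erase (n - 1 - c) ∩ Ioo (n - 1 - c) n = Ioo (n - 1 - c) n := by grind
  have hbound := hφ.sub_le_integral_sq_hajekProj (S := range n) (G := Ioo (n - 1 - c) n)
    (c := n - 1 - c) hd hq hqC (by lia) fun T hT hTc z =>
      hφq (n - 1 - c) T (mem_powersetCard.1 hT).2 (fun j hj => ?_) z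
  · rwa [hinter, hcardIoo, hcard, Nat.cast_pred (by lia)] at hbound
  · obtain ⟨hjc, hjn⟩ := mem_erase.1 ((mem_powersetCard.1 hT).1 hj)
    have hj' := disjoint_left.1 hTc hj
    rw [mem_Ioo] at hj'
    rw [mem_range] at hjn
    lia

end IsCenteredKernel

end HajekVar

section

variable {ι E : Type*} [LinearOrder ι] {r : ℕ} {k : (Fin r → E) → ℝ} {T : Finset ι}

/-- The kernel, indexed by finite sets of observations, which evaluates `k` at the observations
`x i`, `i ∈ T`, taken in increasing order of their indices. It is `0` unless `#T = r`. -/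
def orderedKernel (k : (Fin r → E) → ℝ) (T : Finset ι) (x : ι → E) : ℝ :=
  if h : #T = r then k fun a => x (T.orderEmbOfFin h a) else 0

lemma orderedKernel_of_card_eq (k : (Fin r → E) → ℝ) (h : #T = r) :
    orderedKernel k T = fun x => k fun a => x (T.orderEmbOfFin h a) :=
  funext fun _ => dif_pos h

lemma orderedKernel_sub_const (k : (Fin r → E) → ℝ) (h : #T = r) (x : ι → E) (t : ℝ) :
    orderedKernel (fun y => k y - t) T x = orderedKernel k T x - t := by
  simp only [orderedKernel_of_card_eq _ h]

variable [MeasurableSpace E]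

lemma measurable_orderedKernel (hk : Measurable k) (T : Finset ι) :
    Measurable (orderedKernel k T) := by
  unfold orderedKernel
  split_ifs <;> fun_prop

variable {μ : Measure E} [IsProbabilityMeasure μ] {C : ℝ}

lemma coordProj_orderedKernel (hk : Measurable k) (h : #T = r) (a : Fin r) (z : E) :
    coordProj μ (orderedKernel k T) (T.orderEmbOfFin h a) z = coordProj μ k a z := by
  rw [orderedKernel_of_card_eq k h,
    coordProj_comp_of_injective (T.orderEmbOfFin h).injective hk]

lemma isCenteredKernel_orderedKernel (hk : Measurable k) (hkC : ∀ y, |k y| ≤ C)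
    (hk0 : ∫ y, k y ∂iidLaw (Fin r) μ = 0) :
    IsCenteredKernel μ C (orderedKernel (ι := ι) k) where
  measurable T := measurable_orderedKernel hk T
  dependsOn T x y hxy := by
    unfold orderedKernel
    split_ifs with h
    · exact congrArg k (funext fun a => hxy _ (orderEmbOfFin_mem T h a))
    · rfl
  abs_le T x := by
    obtain ⟨z⟩ := μ.nonempty_of_neZero
    unfold orderedKernel
    split_ifs
    · exact hkC _
    · simpa using (abs_nonneg _).trans (hkC fun _ => z)
  integral_eq_zero T := by
    by_cases h : #T = r
    · have hemb := measurePreserving_comp_of_injective (μ := μ) (T.orderEmbOfFin h).injective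
      rw [orderedKernel_of_card_eq k h, ← hk0, ← hemb.map_eq,
        integral_map hemb.measurable.aemeasurable hk.aestronglyMeasurable]
    · simp [orderedKernel, h]

end

theorem tendstoInDistribution_negTwoLog_elRatio_jackknife_orderedKernel {E : Type*}
    [MeasurableSpace E] {μ : Measure E} [IsProbabilityMeasure μ] {C : ℝ} {d : ℕ}
    {k : (Fin (d + 1) → E) → ℝ} (hd : 1 ≤ d) (hk : Measurable k) (hkC : ∀ y, |k y| ≤ C)
    (hk0 : ∫ y, k y ∂iidLaw (Fin (d + 1)) μ = 0)
    (hpos : 0 < ∫ z, coordProj μ k 0 z ^ 2 ∂μ ∨ 0 < ∫ z, coordProj μ k (Fin.last d) z ^ 2 ∂μ) :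
    TendstoInDistribution (fun n (x : ℕ → E) => negTwoLog (elRatio fun i : Fin n =>
        jackknife (d + 1) (fun T => orderedKernel k T x) (range n) i)) atTop
      (fun y : ℝ => (y : EReal)) (fun _ => iidLaw ℕ μ) chiSquaredOne := by
  have hφ : IsCenteredKernel μ C (orderedKernel (ι := ℕ) k) :=
    isCenteredKernel_orderedKernel hk hkC hk0
  have hproj : ∀ (c : ℕ) (T : Finset ℕ) (h : #(insert c T) = d + 1) (a : Fin (d + 1)) (z : E),
      (insert c T).orderEmbOfFin h a = c →
        coordProj μ (orderedKernel k (insert c T)) c z = coordProj μ k a z := by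
    intro c T h a z hc
    rw [← coordProj_orderedKernel hk h a z, hc]
  obtain ⟨v₀, hv₀, hv⟩ :
      ∃ v₀ > 0, ∀ᶠ n in atTop, v₀ ≤ hajekVar μ d (orderedKernel k) (range n) := by
    rcases hpos with hpos | hpos
    · refine hφ.exists_pos_le_hajekVar_of_forall_gt hd (measurable_coordProj hk 0)
        (abs_coordProj_le hkC 0) hpos fun c T hT hcT z => hproj c T ?_ 0 z ?_
      · rw [card_insert_of_notMem fun hc => (hcT c hc).false, hT]
      · refine (orderEmbOfFin_zero _ d.succ_pos).trans ?_
        exact le_antisymm (min'_le _ _ (mem_insert_self c T)) (le_min' _ _ _ (by grind))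
    · refine hφ.exists_pos_le_hajekVar_of_forall_lt hd (measurable_coordProj hk _)
        (abs_coordProj_le hkC _) hpos fun c T hT hTc z => hproj c T ?_ (Fin.last d) z ?_
      · rw [card_insert_of_notMem fun hc => (hTc c hc).false, hT]
      · refine (orderEmbOfFin_last _ d.succ_pos).trans ?_
        exact le_antisymm (max'_le _ _ _ (by grind)) (le_max' _ _ (mem_insert_self c T))
  exact hφ.tendstoInDistribution_negTwoLog_elRatio_jackknife hd hv₀ hv

end OrderedKernel

section Transfer

variable {Ω : Type*} [MeasurableSpace Ω]

lemma tendstoInDistribution_comp_measurePreserving {Ω' Ω'' G : Type*} [MeasurableSpace Ω']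
    [MeasurableSpace Ω''] [TopologicalSpace G] [MeasurableSpace G] [OpensMeasurableSpace G]
    {P : Measure Ω} {Q : Measure Ω'} {R : Measure Ω''} [IsProbabilityMeasure P]
    [IsProbabilityMeasure Q] [IsProbabilityMeasure R] {Y : ℕ → Ω' → G} {Z : Ω'' → G} {X : Ω → Ω'}
    (hY : TendstoInDistribution Y atTop Z (fun _ => Q) R) (hX : MeasurePreserving X P Q) :
    TendstoInDistribution (fun n ω => Y n (X ω)) atTop Z (fun _ => P) R where
  forall_aemeasurable n := (hY.forall_aemeasurable n).comp_quasiMeasurePreserving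
    hX.quasiMeasurePreserving
  aemeasurable_limit := hY.aemeasurable_limit
  tendsto := by
    refine hY.tendsto.congr fun n => Subtype.ext ?_
    have hYn : AEMeasurable (Y n) (P.map X) := by
      rw [hX.map_eq]
      exact hY.forall_aemeasurable n
    simpa only [hX.map_eq, Function.comp_def] using
      AEMeasurable.map_map_of_aemeasurable hYn hX.measurable.aemeasurable

lemma measurePreserving_iidLaw {ι E : Type*} [MeasurableSpace E] {μ : Measure E} {P : Measure Ω}
    {X : ι → Ω → E} (hX : ∀ i, Measurable (X i)) (hindep : iIndepFun X P)
    (hlaw : ∀ i, P.map (X i) = μ) :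
    MeasurePreserving (fun ω i => X i ω) P (iidLaw ι μ) := by
  refine ⟨by fun_prop, ?_⟩
  simp only [hindep.map_fun_eq_infinitePi_map hX, hlaw]

variable {ι E : Type*} [DecidableEq ι] [MeasurableSpace E] {μ : Measure E} [IsProbabilityMeasure μ]
  {f : (ι → E) → ℝ}

lemma setIntegral_coordProj (hf : Integrable f (iidLaw ι μ)) (i : ι) {t : Set E}
    (ht : MeasurableSet t) :
    ∫ z in t, coordProj μ f i z ∂μ = ∫ x in Function.eval i ⁻¹' t, f x ∂iidLaw ι μ := by
  have hpre : MeasurableSet (Function.eval i ⁻¹' t : Set (ι → E)) := measurable_pi_apply i ht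
  rw [← integral_indicator ht, ← integral_indicator hpre,
    integral_eq_integral_coordProj (hf.indicator hpre) i]
  refine integral_congr_ae <| .of_forall fun z => ?_
  by_cases hz : z ∈ t <;> simp [coordProj, Set.indicator, hz]

theorem coordProj_comp_ae_eq_condExp {P : Measure Ω} [IsProbabilityMeasure P]
    {X : Ω → ι → E} (hX : MeasurePreserving X P (iidLaw ι μ)) {C : ℝ} (hf : Measurable f)
    (hfC : ∀ x, |f x| ≤ C) (i : ι) :
    (fun ω => coordProj μ f i (X ω i)) =ᵐ[P]
      P[fun ω => f (X ω) | MeasurableSpace.comap (fun ω => X ω i) inferInstance] := by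
  have hXi : MeasurePreserving (fun ω => X ω i) P μ :=
    (measurePreserving_eval_infinitePi _ i).comp hX
  have hproj := measurable_coordProj (μ := μ) hf i
  have hfint : Integrable f (iidLaw ι μ) :=
    .of_bound hf.aestronglyMeasurable C (.of_forall hfC)
  have hprojint : Integrable (coordProj μ f i) μ :=
    .of_bound hproj.aestronglyMeasurable C (.of_forall (abs_coordProj_le hfC i))
  refine ae_eq_condExp_of_forall_setIntegral_eq hXi.measurable.comap_le
    (hX.integrable_comp_of_integrable hfint)
    (fun _ _ _ => (hXi.integrable_comp_of_integrable hprojint).integrableOn) ?_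
    (hproj.comp (comap_measurable _)).stronglyMeasurable.aestronglyMeasurable
  rintro _ ⟨t, ht, rfl⟩ -
  calc ∫ ω in (fun ω => X ω i) ⁻¹' t, coordProj μ f i (X ω i) ∂P
      = ∫ z in t, coordProj μ f i z ∂μ := by
        rw [← setIntegral_map ht hproj.aestronglyMeasurable hXi.measurable.aemeasurable,
          hXi.map_eq]
    _ = ∫ x in Function.eval i ⁻¹' t, f x ∂iidLaw ι μ := setIntegral_coordProj hfint i ht
    _ = ∫ ω in (fun ω => X ω i) ⁻¹' t, f (X ω) ∂P := by
        rw [← hX.map_eq]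
        exact setIntegral_map (measurable_pi_apply i ht) hf.aestronglyMeasurable
          hX.measurable.aemeasurable

end Transfer

section KernelMean

/-- The kernel of the test statistic as a function of three observations in the order of their
indices: the largest index comes first in `kern`. -/
def orderedKern (y : Fin 3 → ℝ) : ℝ := kern (y 2) (y 1) (y 0)

lemma measurable_orderedKern : Measurable orderedKern :=
  .ite (measurableSet_le (by fun_prop) (by fun_prop)) measurable_const measurable_const

lemma orderedKern_mem_Icc (y : Fin 3 → ℝ) : orderedKern y ∈ Set.Icc (0 : ℝ) 1 := by
  unfold orderedKern kern
  split_ifs <;> simp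

lemma abs_orderedKern_le_one (y : Fin 3 → ℝ) : |orderedKern y| ≤ 1 := by
  rw [abs_of_nonneg (orderedKern_mem_Icc y).1]
  exact (orderedKern_mem_Icc y).2

variable {F : Measure ℝ} [IsProbabilityMeasure F]

lemma integrable_orderedKern : Integrable orderedKern (iidLaw (Fin 3) F) :=
  .of_bound measurable_orderedKern.aestronglyMeasurable 1 (.of_forall abs_orderedKern_le_one)

lemma measurePreserving_eval_prodMk {ι E : Type*} [MeasurableSpace E] {μ : Measure E}
    [IsProbabilityMeasure μ] {i j : ι} (hij : i ≠ j) :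
    MeasurePreserving (fun x : ι → E => (x i, x j)) (iidLaw ι μ) (μ.prod μ) := by
  have hindep : iIndepFun (fun i (x : ι → E) => x i) (iidLaw ι μ) :=
    iIndepFun_infinitePi (X := fun _ x => x) fun _ => measurable_id
  refine ⟨by fun_prop, ?_⟩
  rw [(indepFun_iff_map_prod_eq_prod_map_map (measurable_pi_apply i).aemeasurable
    (measurable_pi_apply j).aemeasurable).1
    (hindep.indepFun hij), Measure.infinitePi_map_eval, Measure.infinitePi_map_eval]

lemma ae_eval_ne_of_update {ι E : Type*} [DecidableEq ι] [MeasurableSpace E] [MeasurableEq E]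
    {μ : Measure E} [IsProbabilityMeasure μ] [NullSingletonClass μ] {g : (ι → E) → E}
    (hg : Measurable g) (i : ι)
    (hgi : ∀ x z, g (Function.update x i z) = g x) : ∀ᵐ x ∂iidLaw ι μ, x i ≠ g x := by
  have hupd := measurePreserving_update (μ := μ) i
  have hmeas : MeasurableSet {x : ι → E | x i ≠ g x} :=
    (measurableSet_eq_fun (measurable_pi_apply i) hg).compl
  rw [← hupd.map_eq]
  refine (ae_map_iff hupd.measurable.aemeasurable hmeas).2 <|
    (Measure.ae_prod_iff_ae_ae (hupd.measurable hmeas)).2 <| .of_forall fun x => ?_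
  simpa only [Set.mem_ofPred_eq, Function.update_self, hgi] using Measure.ae_ne μ (g x)

lemma coordProj_orderedKern_zero (t : ℝ) :
    coordProj F orderedKern 0 t =
      (F.prod F).real {q : ℝ × ℝ | (q.1 * q.2 - 1) / (2 * q.2) ≤ t} := by
  have hpair := measurePreserving_eval_prodMk (μ := F) (by decide : (2 : Fin 3) ≠ 1)
  have hm : MeasurableSet {q : ℝ × ℝ | (q.1 * q.2 - 1) / (2 * q.2) ≤ t} :=
    measurableSet_le (by fun_prop) measurable_const
  rw [← integral_indicator_one hm, ← hpair.map_eq, integral_map hpair.measurable.aemeasurable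
    (measurable_one.indicator hm).aestronglyMeasurable]
  rfl

lemma integrable_measureReal_Iio : Integrable (fun t => F.real (Set.Iio t)) F :=
  .of_bound (Monotone.measurable fun _ _ hst =>
    measureReal_mono (Set.Iio_subset_Iio hst)).aestronglyMeasurable 1
    (.of_forall fun t => by
      simpa only [Real.norm_of_nonneg measureReal_nonneg] using measureReal_le_one)

lemma integral_measureReal_Iio [NullSingletonClass F] : ∫ t, F.real (Set.Iio t) ∂F = 1 / 2 := by
  have hlt : MeasurableSet {q : ℝ × ℝ | q.2 < q.1} := measurableSet_lt (by fun_prop) (by fun_prop)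
  have hsplit : ∀ t, F.real (Set.Ioi t) = 1 - F.real (Set.Iio t) := fun t => by
    rw [← probReal_compl_eq_one_sub measurableSet_Iio, Set.compl_Iio]
    exact measureReal_congr Ioi_ae_eq_Ici
  have hswap : ∫ t, F.real (Set.Iio t) ∂F = ∫ s, F.real (Set.Ioi s) ∂F := by
    have hIio : ∀ t, F.real (Set.Iio t) =
        ∫ s, {q : ℝ × ℝ | q.2 < q.1}.indicator 1 (t, s) ∂F := fun t =>
      (integral_indicator_one measurableSet_Iio).symm
    have hIoi : ∀ s, F.real (Set.Ioi s) =
        ∫ t, {q : ℝ × ℝ | q.2 < q.1}.indicator 1 (t, s) ∂F := fun s =>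
      (integral_indicator_one measurableSet_Ioi).symm
    simp only [hIio, hIoi]
    exact integral_integral_swap ((integrable_const (1 : ℝ)).indicator hlt)
  have hcompl : ∫ s, F.real (Set.Ioi s) ∂F = 1 - ∫ t, F.real (Set.Iio t) ∂F := by
    simp only [hsplit]
    rw [integral_sub (integrable_const _) integrable_measureReal_Iio]
    simp
  linarith

theorem departure_eq [NullSingletonClass F] :
    departure F = ∫ y, orderedKern y ∂iidLaw (Fin 3) F - 1 / 2 := by
  have hproj : Integrable (coordProj F orderedKern 0) F :=
    .of_bound (measurable_coordProj measurable_orderedKern 0).aestronglyMeasurable 1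
      (.of_forall (abs_coordProj_le abs_orderedKern_le_one 0))
  unfold departure
  simp only [← coordProj_orderedKern_zero]
  rw [integral_sub hproj integrable_measureReal_Iio, integral_measureReal_Iio,
    ← integral_eq_integral_coordProj integrable_orderedKern]

theorem integral_orderedKern_of_map_neg_eq_self [NullSingletonClass F]
    (hF : F.map (fun x => -x) = F) : ∫ y, orderedKern y ∂iidLaw (Fin 3) F = 1 / 2 := by
  have hneg : MeasurePreserving (fun (y : Fin 3 → ℝ) i => -y i) (iidLaw (Fin 3) F)
      (iidLaw (Fin 3) F) := by
    refine ⟨by fun_prop, ?_⟩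
    rw [Measure.infinitePi_map_pi (fun _ => F) fun _ => measurable_neg, hF]
  have hne : ∀ᵐ y ∂iidLaw (Fin 3) F, y 0 ≠ (y 2 * y 1 - 1) / (2 * y 1) :=
    ae_eval_ne_of_update (by fun_prop) 0 fun y z => by simp
  have hflip : (fun y => orderedKern fun i => -y i) =ᵐ[iidLaw (Fin 3) F]
      fun y => 1 - orderedKern y := by
    filter_upwards [hne] with y hy
    have harg : (-y 2 * -y 1 - 1) / (2 * -y 1) = -((y 2 * y 1 - 1) / (2 * y 1)) := by
      rw [neg_mul_neg, mul_neg, div_neg]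
    simp only [orderedKern, kern, harg, neg_le_neg_iff]
    grind
  have hcompl : ∫ y, orderedKern y ∂iidLaw (Fin 3) F =
      1 - ∫ y, orderedKern y ∂iidLaw (Fin 3) F :=
    calc ∫ y, orderedKern y ∂iidLaw (Fin 3) F
        = ∫ y, orderedKern (fun i => -y i) ∂iidLaw (Fin 3) F := by
          conv_lhs => rw [← hneg.map_eq]
          exact integral_map hneg.measurable.aemeasurable
            measurable_orderedKern.aestronglyMeasurable
      _ = ∫ y, 1 - orderedKern y ∂iidLaw (Fin 3) F := integral_congr_ae hflip
      _ = 1 - ∫ y, orderedKern y ∂iidLaw (Fin 3) F := by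
          rw [integral_sub (integrable_const _) integrable_orderedKern]
          simp
  linarith

lemma cauchyMeasure_map_neg : (cauchyMeasure 0 1).map (fun x => -x) = cauchyMeasure 0 1 := by
  rw [cauchyMeasure_of_scale_ne_zero 0 one_ne_zero]
  ext s hs
  rw [Measure.map_apply measurable_neg hs, withDensity_apply _ (measurable_neg hs),
    withDensity_apply _ hs, ← (Measure.measurePreserving_neg
      (volume : Measure ℝ)).setLIntegral_comp_preimage hs (measurable_cauchyPDF 0 1)]
  simp [cauchyPDF, cauchyPDFReal]

end KernelMean

section TestStatistic

section

variable {ι E : Type*} [LinearOrder ι] {r : ℕ}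

lemma orderedKernel_image_univ (f : (Fin r → E) → ℝ) {e : Fin r → ι} (he : StrictMono e)
    (x : ι → E) : orderedKernel f (univ.image e) x = f fun a => x (e a) := by
  have hcard : #(univ.image e) = r := by rw [card_image_of_injective _ he.injective, card_fin]
  rw [orderedKernel_of_card_eq f hcard, ← orderEmbOfFin_unique hcard
    (fun a => mem_image_of_mem e (mem_univ a)) he]

lemma sum_powersetCard_three_orderedKernel (f : (Fin 3 → E) → ℝ) (x : ι → E) (S : Finset ι) :
    ∑ T ∈ S.powersetCard 3, orderedKernel f T x =
      ∑ i ∈ S, ∑ j ∈ S with j < i, ∑ k ∈ S with k < j, f fun a => x (![k, j, i] a) := by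
  have hmono : ∀ {i j k : ι}, k < j → j < i → StrictMono ![k, j, i] := fun hkj hji => by
    simp [hkj, hji]
  simp only [sum_sigma']
  symm
  refine sum_bij (fun t _ => univ.image ![t.2.2, t.2.1, t.1]) ?_ ?_ ?_ ?_
  · rintro ⟨i, j, k⟩ ht
    simp only [mem_sigma, mem_filter] at ht
    refine mem_powersetCard.2 ⟨image_subset_iff.2 fun a _ => ?_, ?_⟩
    · fin_cases a <;> simp [ht]
    · rw [card_image_of_injective _ (hmono ht.2.2.2 ht.2.1.2).injective, card_fin]
  · rintro ⟨i, j, k⟩ ht ⟨i', j', k'⟩ ht' heq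
    simp only [mem_sigma, mem_filter] at ht ht'
    have hrange := congrArg (fun T : Finset ι => (T : Set ι)) heq
    simp only [coe_image, coe_univ, Set.image_univ,
      (hmono ht.2.2.2 ht.2.1.2).range_inj (hmono ht'.2.2.2 ht'.2.1.2)] at hrange
    simp_all
  · intro T hT
    obtain ⟨hTS, hT⟩ := mem_powersetCard.1 hT
    set e := T.orderEmbOfFin hT
    have he : ∀ a, e a ∈ S := fun a => hTS (orderEmbOfFin_mem T hT a)
    refine ⟨⟨e 2, e 1, e 0⟩, by simp [he], ?_⟩
    have hvec : ![e 0, e 1, e 2] = e := by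
      ext a
      fin_cases a <;> rfl
    rw [hvec, image_orderEmbOfFin_univ]
  · rintro ⟨i, j, k⟩ ht
    simp only [mem_sigma, mem_filter] at ht
    exact (orderedKernel_image_univ f (hmono ht.2.2.2 ht.2.1.2) x).symm

lemma uStat_orderedKernel_sub_const (f : (Fin r → E) → ℝ) (x : ι → E) (t : ℝ) {S : Finset ι}
    (hS : r ≤ #S) :
    uStat r (fun T => orderedKernel (fun y => f y - t) T x) S =
      uStat r (fun T => orderedKernel f T x) S - t := by
  calc 𝔼 T ∈ S.powersetCard r, orderedKernel (fun y => f y - t) T x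
      = 𝔼 T ∈ S.powersetCard r, (orderedKernel f T x - t) :=
        expect_congr rfl fun T hT => orderedKernel_sub_const f (mem_powersetCard.1 hT).2 x t
    _ = _ := by rw [expect_sub_distrib, expect_const (powersetCard_nonempty.2 hS), uStat]

end

theorem deltaHat_eq_uStat (x : ℕ → ℝ) (S : Finset ℕ) :
    deltaHat x S = uStat 3 (fun T => orderedKernel orderedKern T x) S - 1 / 2 := by
  have hsum : ∑ i ∈ S, ∑ j ∈ S with j < i, ∑ k ∈ S with k < j, kern (x i) (x j) (x k) =
      (#S).choose 3 * uStat 3 (fun T => orderedKernel orderedKern T x) S := by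
    rw [choose_mul_uStat, sum_powersetCard_three_orderedKernel]
    rfl
  rw [deltaHat, hsum]
  rcases lt_or_ge #S 3 with hS | hS
  · simp [uStat_of_card_lt _ hS]
  · rw [inv_mul_cancel_left₀ (Nat.cast_ne_zero.2 (Nat.choose_pos hS).ne')]

theorem pseudoValue_sub_eq_jackknife (x : ℕ → ℝ) (θ : ℝ) {n i : ℕ} (hi : i < n) (hn : 4 ≤ n) :
    pseudoValue x n i - (θ - 1 / 2) =
      jackknife 3 (fun T => orderedKernel (fun y => orderedKern y - θ) T x) (range n) i := by
  have hcard : #((range n).erase i) = n - 1 := by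
    rw [card_erase_of_mem (mem_range.2 hi), card_range]
  rw [jackknife, uStat_orderedKernel_sub_const _ _ _ (by rw [card_range]; lia),
    uStat_orderedKernel_sub_const _ _ _ (by lia), pseudoValue, deltaHat_eq_uStat,
    deltaHat_eq_uStat, card_range]
  ring

lemma measurable_pseudoValue (n i : ℕ) : Measurable fun x => pseudoValue x n i := by
  have hdelta : ∀ S, Measurable fun x => deltaHat x S := fun S => by
    simp only [deltaHat_eq_uStat]
    exact (measurable_expect fun T _ =>
      measurable_orderedKernel measurable_orderedKern T).sub_const _
  exact ((hdelta _).const_mul _).sub ((hdelta _).const_mul _)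

lemma jelRatio_eq_elRatio (x : ℕ → ℝ) (n : ℕ) (θ : ℝ) :
    jelRatio x n θ = elRatio fun i : Fin n => pseudoValue x n i - θ := by
  have hmean : ∀ p : Fin n → ℝ, p ∈ stdSimplex ℝ (Fin n) →
      (∑ i, p i * (pseudoValue x n i - θ) = 0 ↔ ∑ i, p i * pseudoValue x n i = θ) := by
    intro p hp
    simp only [mul_sub, sum_sub_distrib, ← sum_mul, hp.2, one_mul, sub_eq_zero]
  unfold jelRatio elRatio
  congr 1
  ext r
  simp only [Finset.sum_range, Finset.prod_range, mem_range, Fintype.card_fin, Set.mem_ofPred_eq]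
  constructor
  · rintro ⟨p, hp, hsum, hJ, rfl⟩
    have hsimplex : (fun i : Fin n => p i) ∈ stdSimplex ℝ (Fin n) := ⟨fun i => hp i i.2, hsum⟩
    exact ⟨_, hsimplex, (hmean _ hsimplex).2 hJ, rfl⟩
  · rintro ⟨p, hp, hJ, rfl⟩
    have hextend : ∀ i : Fin n, (if hi : (i : ℕ) < n then p ⟨i, hi⟩ else 0) = p i := by simp
    refine ⟨fun i => if hi : i < n then p ⟨i, hi⟩ else 0, fun i hi => ?_, ?_, ?_, ?_⟩
    · simpa [hi] using hp.1 ⟨i, hi⟩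
    · simp only [hextend, hp.2]
    · simpa only [hextend] using (hmean p hp).1 hJ
    · simp only [hextend]

lemma negTwoLogJEL_eq_negTwoLog_elRatio (x : ℕ → ℝ) (n : ℕ) (θ : ℝ) :
    negTwoLogJEL x n θ = negTwoLog (elRatio fun i : Fin n => pseudoValue x n i - θ) := by
  rw [negTwoLogJEL, jelRatio_eq_elRatio, negTwoLog]

lemma measurable_negTwoLogJEL (n : ℕ) (θ : ℝ) : Measurable fun x => negTwoLogJEL x n θ := by
  simp only [negTwoLogJEL_eq_negTwoLog_elRatio]
  exact continuous_negTwoLog.measurable.comp <| measurable_elRatio.comp <|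
    measurable_pi_lambda _ fun i : Fin n => (measurable_pseudoValue n i).sub_const θ

variable {F : Measure ℝ} [IsProbabilityMeasure F]

lemma memLp_coordProj_orderedKern (a : Fin 3) : MemLp (coordProj F orderedKern a) 2 F :=
  .of_bound (measurable_coordProj measurable_orderedKern a).aestronglyMeasurable 1
    (.of_forall (abs_coordProj_le abs_orderedKern_le_one a))

lemma integral_sq_coordProj_orderedKern_sub (a : Fin 3) :
    ∫ z, coordProj F (fun y => orderedKern y - ∫ y, orderedKern y ∂iidLaw (Fin 3) F) a z ^ 2 ∂F =
      Var[coordProj F orderedKern a; F] := by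
  rw [variance_eq_integral (measurable_coordProj measurable_orderedKern a).aemeasurable,
    ← integral_eq_integral_coordProj integrable_orderedKern]
  refine integral_congr_ae <| .of_forall fun z => ?_
  simp only [coordProj]
  rw [integral_sub (integrable_comp_update measurable_orderedKern abs_orderedKern_le_one a z)
    (integrable_const _)]
  simp

theorem tendstoInDistribution_negTwoLogJEL [NullSingletonClass F]
    (hpos : 0 < Var[coordProj F orderedKern 0; F] ∨ 0 < Var[coordProj F orderedKern 2; F]) :
    TendstoInDistribution (fun n x => negTwoLogJEL x n (departure F)) atTop
      (fun y : ℝ => (y : EReal)) (fun _ => iidLaw ℕ F) chiSquaredOne := by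
  simp only [← integral_sq_coordProj_orderedKern_sub] at hpos
  set θ := ∫ y, orderedKern y ∂iidLaw (Fin 3) F with hθ
  have hbound : ∀ y, |orderedKern y - θ| ≤ 1 + |θ| := fun y =>
    (abs_sub _ _).trans (add_le_add_left (abs_orderedKern_le_one y) _)
  have hcenter : ∫ y, (orderedKern y - θ) ∂iidLaw (Fin 3) F = 0 := by
    rw [integral_sub integrable_orderedKern (integrable_const _)]
    simp [hθ]
  refine tendstoInDistribution_congr_eventually
    (tendstoInDistribution_negTwoLog_elRatio_jackknife_orderedKernel one_le_two
      (measurable_orderedKern.sub_const θ) hbound hcenter hpos)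
    (fun n => (measurable_negTwoLogJEL n _).aemeasurable) ?_
  filter_upwards [eventually_ge_atTop 4] with n hn
  ext x
  simp only [negTwoLogJEL_eq_negTwoLog_elRatio, departure_eq, ← hθ,
    pseudoValue_sub_eq_jackknife x θ (Fin.is_lt _) hn]

lemma coordProj_h (z : ℝ) :
    coordProj F (fun y : Fin 3 → ℝ => h (y 0) (y 1) (y 2)) 0 z =
      1 / 3 * (2 * coordProj F orderedKern 2 z + coordProj F orderedKern 0 z) - 1 / 2 := by
  set u : (Fin 3 → Fin 3) → (Fin 3 → ℝ) → ℝ :=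
    fun σ y => orderedKern fun j => Function.update y 0 z (σ j)
  have hint : ∀ σ, Integrable (u σ) (iidLaw (Fin 3) F) := fun σ =>
    integrable_comp_update (measurable_orderedKern.comp (by fun_prop))
      (fun y => abs_orderedKern_le_one fun j => y (σ j)) 0 z
  have hproj : ∀ {σ : Fin 3 → Fin 3} {a : Fin 3}, Function.Injective σ → σ a = 0 →
      ∫ y, u σ y ∂iidLaw (Fin 3) F = coordProj F orderedKern a z := by
    intro σ a hσ ha
    rw [← coordProj_comp_of_injective hσ measurable_orderedKern a z, ha, coordProj]
  calc coordProj F (fun y : Fin 3 → ℝ => h (y 0) (y 1) (y 2)) 0 z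
      = ∫ y, (1 / 3 * (u ![2, 1, 0] y + u ![1, 2, 0] y + u ![0, 2, 1] y) - 1 / 2)
          ∂iidLaw (Fin 3) F := rfl
    _ = 1 / 3 * (∫ y, u ![2, 1, 0] y ∂iidLaw (Fin 3) F + ∫ y, u ![1, 2, 0] y ∂iidLaw (Fin 3) F +
          ∫ y, u ![0, 2, 1] y ∂iidLaw (Fin 3) F) - 1 / 2 := by
        have hadd : ∀ σ τ, Integrable (fun y => u σ y + u τ y) (iidLaw (Fin 3) F) := fun σ τ =>
          (hint σ).add (hint τ)
        have hadd₃ : ∀ σ τ υ, Integrable (fun y => u σ y + u τ y + u υ y) (iidLaw (Fin 3) F) :=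
          fun σ τ υ => (hadd σ τ).add (hint υ)
        rw [integral_sub ((hadd₃ _ _ _).const_mul _) (integrable_const _), integral_const_mul,
          integral_add (hadd _ _) (hint _), integral_add (hint _) (hint _)]
        simp
    _ = 1 / 3 * (2 * coordProj F orderedKern 2 z + coordProj F orderedKern 0 z) - 1 / 2 := by
        rw [hproj (a := 2) (by decide) rfl, hproj (a := 2) (by decide) rfl,
          hproj (a := 0) (by decide) rfl]
        ring

lemma abs_h_le_one (x₁ x₂ x₃ : ℝ) : |h x₁ x₂ x₃| ≤ 1 := by
  unfold h kern
  split_ifs <;> norm_num [abs_le]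

lemma measurable_h_eval : Measurable fun y : Fin 3 → ℝ => h (y 0) (y 1) (y 2) := by
  have hperm : ∀ σ : Fin 3 → Fin 3, Measurable fun y : Fin 3 → ℝ => orderedKern fun j => y (σ j) :=
    fun σ => measurable_orderedKern.comp (by fun_prop)
  exact ((((hperm ![2, 1, 0]).add (hperm ![1, 2, 0])).add
    (hperm ![0, 2, 1])).const_mul _).sub_const _

theorem variance_coordProj_orderedKern_pos {Ω : Type*} [MeasurableSpace Ω] {P : Measure Ω}
    [IsProbabilityMeasure P] {X : Ω → Fin 3 → ℝ} (hX : MeasurePreserving X P (iidLaw (Fin 3) F))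
    (hσ : 0 < Var[P[fun ω => h (X ω 0) (X ω 1) (X ω 2) |
      MeasurableSpace.comap (fun ω => X ω 0) inferInstance]; P]) :
    0 < Var[coordProj F orderedKern 0; F] ∨ 0 < Var[coordProj F orderedKern 2; F] := by
  have hX₀ : MeasurePreserving (fun ω => X ω 0) P F :=
    (measurePreserving_eval_infinitePi _ 0).comp hX
  rw [← variance_congr (coordProj_comp_ae_eq_condExp hX measurable_h_eval
    (fun y => abs_h_le_one _ _ _) 0),
    hX₀.variance_fun_comp (measurable_coordProj measurable_h_eval 0).aemeasurable] at hσ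
  by_contra! hzero
  obtain ⟨h₀, h₂⟩ := hzero
  have hconst : ∀ a, Var[coordProj F orderedKern a; F] ≤ 0 →
      coordProj F orderedKern a =ᵐ[F] fun _ => ∫ z, coordProj F orderedKern a z ∂F := fun a ha =>
    ae_eq_integral_of_variance_eq_zero (memLp_coordProj_orderedKern a)
      (ha.antisymm (variance_nonneg _ _))
  have hproj : coordProj F (fun y : Fin 3 → ℝ => h (y 0) (y 1) (y 2)) 0 =ᵐ[F]
      fun _ => 1 / 3 * (2 * ∫ z, coordProj F orderedKern 2 z ∂F +
        ∫ z, coordProj F orderedKern 0 z ∂F) - 1 / 2 := by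
    filter_upwards [hconst 0 h₀, hconst 2 h₂] with z hz₀ hz₂
    rw [coordProj_h, hz₀, hz₂]
  rw [variance_congr hproj, variance_eq_integral aemeasurable_const] at hσ
  simp at hσ

end TestStatistic

end CauchyJEL

end

theorem theorem3 {Ω : Type*} [mΩ : MeasurableSpace Ω] (P : Measure Ω) [IsProbabilityMeasure P]
    (F : Measure ℝ) [NullSingletonClass F]
    (X : ℕ → Ω → ℝ) (hX : ∀ i, Measurable (X i))
    (hindep : iIndepFun X P) (hlaw : ∀ i, P.map (X i) = F)
    (hh : MemLp (fun ω => CauchyJEL.h (X 0 ω) (X 1 ω) (X 2 ω)) 2 P)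
    (hσ : 0 < variance
      (P[fun ω => CauchyJEL.h (X 0 ω) (X 1 ω) (X 2 ω) |
        MeasurableSpace.comap (X 0) inferInstance]) P) :
    TendstoInDistribution
      (fun (n : ℕ) ω =>
        CauchyJEL.negTwoLogJEL (fun i => X i ω) n (CauchyJEL.departure F))
      atTop (fun z : ℝ => (z : EReal)) (fun _ => P) CauchyJEL.chiSquaredOne ∧
    (F = cauchyMeasure 0 1 →
      CauchyJEL.departure F = 0 ∧
      TendstoInDistribution
        (fun (n : ℕ) ω => CauchyJEL.negTwoLogJEL (fun i => X i ω) n 0)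
        atTop (fun z : ℝ => (z : EReal)) (fun _ => P) CauchyJEL.chiSquaredOne) := by
  have hF : IsProbabilityMeasure F := hlaw 0 ▸ Measure.isProbabilityMeasure_map (hX 0).aemeasurable
  have hsample := CauchyJEL.measurePreserving_iidLaw hX hindep hlaw
  have htriple : MeasurePreserving (fun ω (a : Fin 3) => X a ω) P (CauchyJEL.iidLaw (Fin 3) F) :=
    (CauchyJEL.measurePreserving_comp_of_injective Fin.val_injective).comp hsample
  have hlim := CauchyJEL.tendstoInDistribution_comp_measurePreserving
    (CauchyJEL.tendstoInDistribution_negTwoLogJEL <|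
      CauchyJEL.variance_coordProj_orderedKern_pos htriple hσ) hsample
  refine ⟨hlim, fun hcauchy => ?_⟩
  have hzero : CauchyJEL.departure F = 0 := by
    rw [CauchyJEL.departure_eq, CauchyJEL.integral_orderedKern_of_map_neg_eq_self
      (by rw [hcauchy, CauchyJEL.cauchyMeasure_map_neg]), sub_self]
  exact ⟨hzero, by simpa only [hzero] using hlim⟩
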